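/- Let $\mu,\lambda,L,T>0$ and $a\in\mathbb R$. Let $(u,w)$ be an exact solution of $$u_t-\mu w_t+uu_x+u_x-\lambda w=0,\qquad w=u_{xx},\qquad x\in\mathbb R,\ 0<t\le T,$$ with $u(x+L,t)=u(x,t)$ for $0<t\le T$ and $u(x,0)=\phi(x)$, and suppose that $u\in C^{6,1}\cap C^{2,3}$ on $\mathbb R\times[0,T]$, i.e. the partial derivatives $\partial_x^i\partial_t^j u$ with $i\le 6,\ j\le 1$ or with $i\le 2,\ j\le 3$ exist and are continuous there. Put $$C_0=\max_{\mathbb R\times[0,T]}\{|u|,|u_x|,|u_{xx}|,|u_{xxx}|\},\qquad C_1=\max\Big\{\tfrac{L}{2\lambda}+\tfrac{20C_0^2}{9\lambda}+\tfrac{19C_0^2L^2}{108\lambda}+\tfrac1\lambda,\ \tfrac{16C_0^2}{\lambda}+\tfrac{9L}{\lambda}+\tfrac3\lambda\Big\}.$$ For positive integers $M,N_c$ let $h=L/M$, $\tau_c=T/N_c$, $x_p=a+ph$. For $M$-periodic grid functions $v,w$ write $\delta_xv_{p-1/2}=\frac{v_p-v_{p-1}}h$, $\delta_{xx}v_p=\frac{v_{p+1}-2v_p+v_{p-1}}{h^2}$,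 $\Delta_xv_p=\frac{v_{p+1}-v_{p-1}}{2h}$, $\Psi(v,w)_p=\frac13[v_p\Delta_xw_p+\Delta_x(vw)_p]$; $\|v\|^2=h\sum_{p=1}^Mv_p^2$, $|v|_1^2=h\sum_{p=1}^M(\delta_xv_{p-1/2})^2$, $\|v\|_\infty=\max_{1\le p\le M}|v_p|$; and, for sequences $v^q$, $v^{q-1/2}=\frac12(v^q+v^{q-1})$, $\delta_tv^{q-1/2}=\frac{v^q-v^{q-1}}{\tau_c}$. Let the $M$-periodic grid functions $(u_c)^q,(w_c)^q$, $0\le q\le N_c$, solve the nonlinear compact Crank–Nicolson scheme $$\delta_t(u_c)_p^{q-\frac12}-\mu\,\delta_t(w_c)_p^{q-\frac12}+\Psi\big((u_c)^{q-\frac12},(u_c)^{q-\frac12}\big)_p-\tfrac{h^2}2\Psi\big((w_c)^{q-\frac12},(u_c)^{q-\frac12}\big)_p+\Delta_x(u_c)_p^{q-\frac12}-\tfrac{h^2}6\Delta_x(w_c)_p^{q-\frac12}-\lambda(w_c)_p^{q-\frac12}=0$$ for $1\le p\le M$, $1\le q\le N_c$, with $(w_c)_p^q=\delta_{xx}(u_c)_p^q-\frac{h^2}{12}\delta_{xx}(w_c)_p^q$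 for $1\le p\le M$, $0\le q\le N_c$, and $(u_c)_p^0=\phi(x_p)$. Let $(e_c)_p^q=u(x_p,q\tau_c)-(u_c)_p^q$. Then there is a constant $C>0$, independent of $M$ and $N_c$ (that is, of $h$ and $\tau_c$) and of the numerical solution, such that whenever $2C_1\tau_c<\frac13$ and $\tau_c^2+h^4\le 1/C$, one has for all $0\le q\le N_c$ $$|(e_c)^q|_1\le C(\tau_c^2+h^4),\qquad \|(e_c)^q\|\le\frac{LC}{\sqrt6}(\tau_c^2+h^4),\qquad \|(e_c)^q\|_\infty\le\frac{C\sqrt L}{2}(\tau_c^2+h^4).$$ -/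

import Mathlib

open Set

noncomputable section

namespace BBMB

/-! ## The continuous problem

A function of space and time is `u : ℝ → ℝ → ℝ`, written `u x t`. -/

/-- `u` is of class `C^{m,n}` on the closed strip `ℝ × [0,T]`: every mixed partial derivative
`D i j = ∂ₓⁱ ∂ₜʲ u` with `i ≤ m` and `j ≤ n` exists and is jointly continuous on the strip
(one-sided time derivatives at `t = 0` and `t = T`). -/
def MixedSmooth (m n : ℕ) (T : ℝ) (u : ℝ → ℝ → ℝ) : Prop :=
  ∃ D : ℕ → ℕ → ℝ → ℝ → ℝ,
    (∀ x, ∀ t ∈ Icc 0 T, D 0 0 x t = u x t) ∧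
    ∀ i ≤ m, ∀ j ≤ n,
      ContinuousOn (fun z : ℝ × ℝ => D i j z.1 z.2) (univ ×ˢ Icc 0 T) ∧
      (i < m → ∀ x, ∀ t ∈ Icc 0 T, HasDerivAt (fun y => D i j y t) (D (i + 1) j x t) x) ∧
      (j < n → ∀ x, ∀ t ∈ Icc 0 T,
        HasDerivWithinAt (fun s => D i j x s) (D i (j + 1) x t) (Icc 0 T) t)

/-- `(u, w)` is an exact solution of the periodic initial value problem
`u_t - μ w_t + u u_x + u_x - λ w = 0`, `w = u_xx` on `ℝ × (0,T]`, `u` being `L`-periodic in space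
with initial value `φ`. The last two fields are the regularity of `u`. -/
structure IsExactSolution (μ lam L T : ℝ) (φ : ℝ → ℝ) (u w : ℝ → ℝ → ℝ) : Prop where
  equation : ∀ x, ∀ t ∈ Ioc 0 T,
    derivWithin (fun s => u x s) (Icc 0 T) t - μ * derivWithin (fun s => w x s) (Icc 0 T) t
      + u x t * deriv (fun y => u y t) x + deriv (fun y => u y t) x - lam * w x t = 0
  aux : ∀ x, ∀ t ∈ Ioc 0 T, w x t = iteratedDeriv 2 (fun y => u y t) x
  periodic : ∀ x, ∀ t ∈ Ioc 0 T, u x t = u (x + L) t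
  initial : ∀ x, u x 0 = φ x
  smooth_space : MixedSmooth 6 1 T u
  smooth_time : MixedSmooth 2 3 T u

/-- The maximum over `ℝ × [0,T]` of `|u|, |u_x|, |u_xx|, |u_xxx|`. -/
def C0 (T : ℝ) (u : ℝ → ℝ → ℝ) : ℝ :=
  sSup {r : ℝ | ∃ x : ℝ, ∃ t ∈ Icc 0 T, ∃ k ≤ 3, r = |iteratedDeriv k (fun y => u y t) x|}

/-- The constant `C₁` in the time step restriction; its last argument is `C₀`. -/
def C1 (lam L c0 : ℝ) : ℝ :=
  max (L / (2 * lam) + 20 * c0 ^ 2 / (9 * lam) + 19 * c0 ^ 2 * L ^ 2 / (108 * lam) + 1 / lam)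
    (16 * c0 ^ 2 / lam + 9 * L / lam + 3 / lam)

/-! ## Grid functions

A spatial grid function is `w : ℤ → ℝ`, and a space-time grid function is `v : ℕ → ℤ → ℝ`, written
`v q p` with time index `q` and space index `p`. -/

/-- The space of `M`-periodic grid functions. -/
def gridSpace (M : ℕ) : Set (ℤ → ℝ) := {w | ∀ p : ℤ, w (p + M) = w p}

/-- The value of `δₓ w` at the half point `p - 1/2`. -/
def dxHalf (h : ℝ) (w : ℤ → ℝ) (p : ℤ) : ℝ := (w p - w (p - 1)) / h

/-- `δₓₓ w` at `p`. -/
def dxx (h : ℝ) (w : ℤ → ℝ) (p : ℤ) : ℝ := (dxHalf h w (p + 1) - dxHalf h w p) / h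

/-- `Δₓ w` at `p`. -/
def dxCentral (h : ℝ) (w : ℤ → ℝ) (p : ℤ) : ℝ := (w (p + 1) - w (p - 1)) / (2 * h)

/-- `Ψ(v,w)` at `p`. -/
def Psi (h : ℝ) (v w : ℤ → ℝ) (p : ℤ) : ℝ :=
  (1 / 3) * (v p * dxCentral h w p + dxCentral h (fun k => v k * w k) p)

/-- The average `v^{q - 1/2}`, for `q ≥ 1`. -/
def midAvg (v : ℕ → ℤ → ℝ) (q : ℕ) (p : ℤ) : ℝ := (v q p + v (q - 1) p) / 2

/-- The time difference quotient `δₜ v^{q - 1/2}`, for `q ≥ 1`. -/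
def dt (τ : ℝ) (v : ℕ → ℤ → ℝ) (q : ℕ) (p : ℤ) : ℝ := (v q p - v (q - 1) p) / τ

/-- The discrete `L²` norm. -/
def normL2 (M : ℕ) (h : ℝ) (w : ℤ → ℝ) : ℝ :=
  Real.sqrt (h * ∑ p ∈ Finset.Icc (1 : ℤ) M, w p * w p)

/-- The discrete `H¹` seminorm. -/
def seminormH1 (M : ℕ) (h : ℝ) (w : ℤ → ℝ) : ℝ :=
  Real.sqrt (h * ∑ p ∈ Finset.Icc (1 : ℤ) M, dxHalf h w p * dxHalf h w p)

/-- The discrete maximum norm. -/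
def normMax (M : ℕ) (w : ℤ → ℝ) : ℝ := ⨆ p : Icc (1 : ℤ) M, |w p|

/-- `(uc, wc)` solves the nonlinear compact Crank-Nicolson scheme with `M` space points
`x_p = a + p h` per period, space step `h`, and `N` time steps of size `τ`. -/
structure IsNumericalSolution (μ lam a h τ : ℝ) (M N : ℕ) (φ : ℝ → ℝ)
    (uc wc : ℕ → ℤ → ℝ) : Prop where
  scheme : ∀ q : ℕ, 1 ≤ q → q ≤ N → ∀ p : ℤ, 1 ≤ p → p ≤ M →
    dt τ uc q p - μ * dt τ wc q p + Psi h (midAvg uc q) (midAvg uc q) p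
      - h ^ 2 / 2 * Psi h (midAvg wc q) (midAvg uc q) p
      + dxCentral h (midAvg uc q) p - h ^ 2 / 6 * dxCentral h (midAvg wc q) p
      - lam * midAvg wc q p = 0
  aux : ∀ q : ℕ, q ≤ N → ∀ p : ℤ, 1 ≤ p → p ≤ M →
    wc q p = dxx h (uc q) p - h ^ 2 / 12 * dxx h (wc q) p
  periodic : ∀ q : ℕ, q ≤ N → uc q ∈ gridSpace M ∧ wc q ∈ gridSpace M
  initial : ∀ p : ℤ, 1 ≤ p → p ≤ M → uc 0 p = φ (a + p * h)

/-- The error `e^q_p = u(x_p, q τ) - (uc)^q_p`. -/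
def gridError (u : ℝ → ℝ → ℝ) (a h τ : ℝ) (uc : ℕ → ℤ → ℝ) (q : ℕ) (p : ℤ) : ℝ :=
  u (a + p * h) (q * τ) - uc q p

end BBMB

end

/-! The proof is an energy estimate for the error at the grid points. Let `U` be the grid values of
`u`. Instead of comparing `wc` with the values `W` of `u_xx`, it is compared with `V`, the grid
function obtained from `U` by solving the compact relation exactly. Then `e = U - uc` and `f = V -
wc` satisfy that relation with no residual, and the defect `s = V - W` is moved into the residual of
the scheme. A maximum principle makes `s` of order `h ^ 4`, and its time difference quotient as
well, because `∂ₓ⁶∂ₜu` is bounded.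

The energy is `‖e‖² - μ (f, e)`. The compact relation makes `(f, e')` symmetric and `-(f, e)` at
least `|e|₁² + h²‖f‖²/18` (`IsCompactLaplacian.le_neg_gridInner`), so the energy dominates `‖e‖²`,
`|e|₁²` and `h²‖f‖²`. In the scheme tested with the mean error, the nonlinear difference splits as
`Ψ(U,U) - Ψ(uc,uc) = Ψ(e,U) + Ψ(uc,e)`, and similarly for the `h²` term. The parts carrying the
numerical solution vanish by skew symmetry (`gridInner_Psi_self`), hence no a priori bound on `uc`
or `wc` is needed; the other parts need only bounds on the exact solution (`energy_step`).

Taylor expansion bounds the residual by a multiple of `τ² + h⁴` (`ExactData.consistency`). The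
initial energy is zero, so `discrete_gronwall` bounds the energy by a multiple of `(τ² + h⁴)²`, and
`normMax_le` turns the two norms into the maximum norm. -/

namespace BBMB

/-! ### Summation by parts, the compact Laplacian and the skew-symmetric product `Psi`. -/

/-- The discrete `L²` inner product. -/
noncomputable def gridInner (M : ℕ) (h : ℝ) (v w : ℤ → ℝ) : ℝ :=
  h * ∑ p ∈ Finset.Icc (1 : ℤ) M, v p * w p

/-- `f` is the compact fourth order approximation of the second derivative of `e`. -/
def IsCompactLaplacian (M : ℕ) (h : ℝ) (e f : ℤ → ℝ) : Prop :=
  ∀ p : ℤ, 1 ≤ p → p ≤ M → f p = dxx h e p - h ^ 2 / 12 * dxx h f p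

theorem sum_Icc_one_eq_sum_range (M : ℕ) (g : ℤ → ℝ) :
    ∑ p ∈ Finset.Icc (1 : ℤ) M, g p = ∑ k ∈ Finset.range M, g (k + 1) := by
  induction M with
  | zero => simp
  | succ n ih =>
    have : Finset.Icc (1 : ℤ) ((n + 1 : ℕ) : ℤ) = insert ((n : ℤ) + 1) (Finset.Icc (1 : ℤ) n) := by
      ext p
      simp only [Finset.mem_Icc, Finset.mem_insert]
      push_cast
      omega
    rw [this, Finset.sum_insert (by simp), ih, Finset.sum_range_succ, add_comm]

theorem sum_shift {M : ℕ} {g : ℤ → ℝ} (hg : g ∈ gridSpace M) :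
    ∑ p ∈ Finset.Icc (1 : ℤ) M, g (p + 1) = ∑ p ∈ Finset.Icc (1 : ℤ) M, g p := by
  have h1 := sum_Icc_one_eq_sum_range M (fun p => g (p + 1))
  have h2 := Finset.sum_range_succ (fun k : ℕ => g ((k : ℤ) + 1)) M
  have h3 := Finset.sum_range_succ' (fun k : ℕ => g ((k : ℤ) + 1)) M
  have h4 : g ((M : ℤ) + 1) = g 1 := by rw [add_comm]; exact hg 1
  rw [h1, sum_Icc_one_eq_sum_range M g]
  push_cast at h3
  linarith

theorem sum_telescope {M : ℕ} {G g : ℤ → ℝ} (hG : G ∈ gridSpace M)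
    (hg : ∀ p, g p = G (p + 1) - G p) :
    ∑ p ∈ Finset.Icc (1 : ℤ) M, g p = 0 := by
  simp only [hg, Finset.sum_sub_distrib, sum_shift hG, sub_self]

theorem gridSpace_pred {M : ℕ} {v : ℤ → ℝ} (hv : v ∈ gridSpace M) (p : ℤ) :
    v (p + M - 1) = v (p - 1) := by
  rw [show p + (M : ℤ) - 1 = p - 1 + M by ring]; exact hv _

theorem gridSpace_succ {M : ℕ} {v : ℤ → ℝ} (hv : v ∈ gridSpace M) (p : ℤ) :
    v (p + M + 1) = v (p + 1) := by
  rw [show p + (M : ℤ) + 1 = p + 1 + M by ring]; exact hv _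

theorem dxHalf_mem {M : ℕ} {v : ℤ → ℝ} (h : ℝ) (hv : v ∈ gridSpace M) :
    dxHalf h v ∈ gridSpace M := fun p => by
  simp only [dxHalf, gridSpace_pred hv, hv p]

theorem gridInner_comm (M : ℕ) (h : ℝ) (v w : ℤ → ℝ) :
    gridInner M h v w = gridInner M h w v := by
  simp only [gridInner, mul_comm]

theorem gridInner_self_nonneg (M : ℕ) {h : ℝ} (hh : 0 < h) (v : ℤ → ℝ) :
    0 ≤ gridInner M h v v :=
  mul_nonneg hh.le (Finset.sum_nonneg fun _ _ => mul_self_nonneg _)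

/-- An inequality between quadratic expressions that holds pointwise holds after summation. -/
theorem gridSum_le (M : ℕ) {h : ℝ} (hh : 0 < h) {f g : ℤ → ℝ}
    (hfg : ∀ p : ℤ, 1 ≤ p → p ≤ M → f p ≤ g p) :
    h * ∑ p ∈ Finset.Icc (1 : ℤ) M, f p ≤ h * ∑ p ∈ Finset.Icc (1 : ℤ) M, g p :=
  mul_le_mul_of_nonneg_left
    (Finset.sum_le_sum fun p hp => hfg p (Finset.mem_Icc.1 hp).1 (Finset.mem_Icc.1 hp).2) hh.le

theorem gridSum_congr (M : ℕ) {h : ℝ} {f g : ℤ → ℝ}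
    (hfg : ∀ p : ℤ, 1 ≤ p → p ≤ M → f p = g p) :
    h * ∑ p ∈ Finset.Icc (1 : ℤ) M, f p = h * ∑ p ∈ Finset.Icc (1 : ℤ) M, g p := by
  rw [Finset.sum_congr rfl fun p hp => hfg p (Finset.mem_Icc.1 hp).1 (Finset.mem_Icc.1 hp).2]

theorem gridInner_dxCentral {M : ℕ} (h : ℝ) {v w : ℤ → ℝ} (hv : v ∈ gridSpace M)
    (hw : w ∈ gridSpace M) :
    gridInner M h (dxCentral h v) w = -gridInner M h v (dxCentral h w) := by
  have := sum_telescope (M := M) (G := fun p => (v p * w (p - 1) + v (p - 1) * w p) / (2 * h))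
    (g := fun p => dxCentral h v p * w p + v p * dxCentral h w p)
    (fun p => by simp only [gridSpace_pred hv, gridSpace_pred hw, hv p, hw p])
    (fun p => by simp only [dxCentral, add_sub_cancel_right]; ring)
  rw [Finset.sum_add_distrib] at this
  simp only [gridInner]
  linear_combination h * this

theorem gridInner_dxx {M : ℕ} (h : ℝ) {v w : ℤ → ℝ} (hv : v ∈ gridSpace M)
    (hw : w ∈ gridSpace M) :
    gridInner M h (dxx h v) w = -gridInner M h (dxHalf h v) (dxHalf h w) := by
  have := sum_telescope (M := M) (G := fun p => dxHalf h v p / h * w (p - 1))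
    (g := fun p => dxx h v p * w p + dxHalf h v p * dxHalf h w p)
    (fun p => by simp only [gridSpace_pred hw, dxHalf_mem h hv p])
    (fun p => by simp only [dxx, add_sub_cancel_right]; simp only [dxHalf]; ring)
  rw [Finset.sum_add_distrib] at this
  simp only [gridInner]
  linear_combination h * this

theorem gridInner_dxCentral_self_le {M : ℕ} {h : ℝ} (hh : 0 < h) {v : ℤ → ℝ}
    (hv : v ∈ gridSpace M) :
    gridInner M h (dxCentral h v) (dxCentral h v) ≤ gridInner M h (dxHalf h v) (dxHalf h v) := by
  have h1 := sum_shift (M := M) (g := fun p => dxHalf h v p * dxHalf h v p)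
    (fun p => by simp only [dxHalf_mem h hv p])
  have h2 := gridSum_le M hh (f := fun p => dxCentral h v p * dxCentral h v p)
    (g := fun p => dxHalf h v (p + 1) * dxHalf h v (p + 1) / 2 + dxHalf h v p * dxHalf h v p / 2)
    (fun p _ _ => by
      have : dxCentral h v p = (dxHalf h v (p + 1) + dxHalf h v p) / 2 := by
        simp only [dxCentral, dxHalf, add_sub_cancel_right]; field_simp; ring
      rw [this]
      nlinarith [sq_nonneg (dxHalf h v (p + 1) - dxHalf h v p)])
  rw [Finset.sum_add_distrib, ← Finset.sum_div, ← Finset.sum_div] at h2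
  simp only [gridInner]
  rw [h1] at h2
  linarith

/-- Inverse inequality: it absorbs the term of wrong sign in `IsCompactLaplacian.gridInner_eq`. -/
theorem gridInner_dxHalf_self_le {M : ℕ} {h : ℝ} (hh : 0 < h) {v : ℤ → ℝ}
    (hv : v ∈ gridSpace M) :
    h ^ 2 * gridInner M h (dxHalf h v) (dxHalf h v) ≤ 4 * gridInner M h v v := by
  have h1 := sum_shift (M := M) (g := fun p => v (p - 1) * v (p - 1))
    (fun p => by simp only [gridSpace_pred hv])
  have h2 := gridSum_le M hh (f := fun p => h ^ 2 * (dxHalf h v p * dxHalf h v p))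
    (g := fun p => 2 * (v p * v p) + 2 * (v (p - 1) * v (p - 1)))
    (fun p _ _ => by
      have : h ^ 2 * (dxHalf h v p * dxHalf h v p) = (v p - v (p - 1)) ^ 2 := by
        simp only [dxHalf]; field_simp
      rw [this]
      nlinarith [sq_nonneg (v p + v (p - 1))])
  rw [Finset.sum_add_distrib, ← Finset.mul_sum, ← Finset.mul_sum, ← Finset.mul_sum] at h2
  simp only [add_sub_cancel_right] at h1
  rw [← h1] at h2
  simp only [gridInner]
  linarith

/-- The first relation is tested with `e'`; the cross term `(δₓf, δₓe')` that appears is eliminated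
by testing the second relation with `f`. The outcome is symmetric in the two pairs. -/
theorem IsCompactLaplacian.gridInner_eq {M : ℕ} {h : ℝ} {e f e' f' : ℤ → ℝ}
    (he : e ∈ gridSpace M) (hf : f ∈ gridSpace M) (he' : e' ∈ gridSpace M)
    (hf' : f' ∈ gridSpace M) (H : IsCompactLaplacian M h e f)
    (H' : IsCompactLaplacian M h e' f') :
    -gridInner M h f e' = gridInner M h (dxHalf h e) (dxHalf h e')
      + h ^ 2 / 12 * gridInner M h f f'
      - h ^ 4 / 144 * gridInner M h (dxHalf h f) (dxHalf h f') := by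
  have h1 : gridInner M h f e' =
      gridInner M h (dxx h e) e' - h ^ 2 / 12 * gridInner M h (dxx h f) e' := by
    simp only [gridInner]
    rw [gridSum_congr M (f := fun p => f p * e' p)
      (g := fun p => dxx h e p * e' p - h ^ 2 / 12 * (dxx h f p * e' p))
      (fun p h1 h2 => by linear_combination e' p * H p h1 h2)]
    rw [Finset.sum_sub_distrib, ← Finset.mul_sum]; ring
  have h2 : gridInner M h f' f =
      gridInner M h (dxx h e') f - h ^ 2 / 12 * gridInner M h (dxx h f') f := by
    simp only [gridInner]
    rw [gridSum_congr M (f := fun p => f' p * f p)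
      (g := fun p => dxx h e' p * f p - h ^ 2 / 12 * (dxx h f' p * f p))
      (fun p h1 h2 => by linear_combination f p * H' p h1 h2)]
    rw [Finset.sum_sub_distrib, ← Finset.mul_sum]; ring
  rw [gridInner_dxx h he he', gridInner_dxx h hf he'] at h1
  rw [gridInner_dxx h he' hf, gridInner_dxx h hf' hf, gridInner_comm M h f' f,
    gridInner_comm M h (dxHalf h f') _, gridInner_comm M h (dxHalf h e') _] at h2
  linear_combination -h1 - h ^ 2 / 12 * h2

theorem IsCompactLaplacian.gridInner_symm {M : ℕ} {h : ℝ} {e f e' f' : ℤ → ℝ}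
    (he : e ∈ gridSpace M) (hf : f ∈ gridSpace M) (he' : e' ∈ gridSpace M)
    (hf' : f' ∈ gridSpace M) (H : IsCompactLaplacian M h e f)
    (H' : IsCompactLaplacian M h e' f') :
    gridInner M h f e' = gridInner M h f' e := by
  have h1 := H.gridInner_eq he hf he' hf' H'
  have h2 := H'.gridInner_eq he' hf' he hf H
  rw [gridInner_comm M h f' f, gridInner_comm M h (dxHalf h f') _,
    gridInner_comm M h (dxHalf h e') _] at h2
  linarith

/-- The inverse inequality gives `h⁴/144 |f|₁² ≤ h²/36 ‖f‖²`, and `1/12 - 1/36 = 1/18`. -/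
theorem IsCompactLaplacian.le_neg_gridInner {M : ℕ} {h : ℝ} (hh : 0 < h) {e f : ℤ → ℝ}
    (he : e ∈ gridSpace M) (hf : f ∈ gridSpace M) (H : IsCompactLaplacian M h e f) :
    gridInner M h (dxHalf h e) (dxHalf h e) + h ^ 2 / 18 * gridInner M h f f
      ≤ -gridInner M h f e := by
  have h1 := H.gridInner_eq he hf he hf H
  have h2 := mul_le_mul_of_nonneg_left (gridInner_dxHalf_self_le hh hf)
    (show 0 ≤ h ^ 2 / 144 by positivity)
  rw [h1]
  linarith

/-- The energy of an error `e` with compact Laplacian `f`. -/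
noncomputable def gridEnergy (μ : ℝ) (M : ℕ) (h : ℝ) (e f : ℤ → ℝ) : ℝ :=
  gridInner M h e e - μ * gridInner M h f e

theorem sum_norms_le_gridEnergy {μ : ℝ} (hμ : 0 < μ) {M : ℕ} {h : ℝ} (hh : 0 < h) {e f : ℤ → ℝ}
    (he : e ∈ gridSpace M) (hf : f ∈ gridSpace M) (H : IsCompactLaplacian M h e f) :
    gridInner M h e e + gridInner M h (dxHalf h e) (dxHalf h e) + h ^ 2 * gridInner M h f f
      ≤ (1 + 18 / μ) * gridEnergy μ M h e f := by
  have h1 := mul_le_mul_of_nonneg_left (H.le_neg_gridInner hh he hf) hμ.le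
  have n1 := gridInner_self_nonneg M hh e
  have n2 := gridInner_self_nonneg M hh (dxHalf h e)
  have n3 := gridInner_self_nonneg M hh f
  have h2 : gridInner M h e e + μ * gridInner M h (dxHalf h e) (dxHalf h e)
      + μ * (h ^ 2 / 18 * gridInner M h f f) ≤ gridEnergy μ M h e f := by
    unfold gridEnergy; linarith
  have h3 := mul_le_mul_of_nonneg_left h2 (show 0 ≤ 1 + 18 / μ by positivity)
  refine le_trans ?_ h3
  have : (1 + 18 / μ) * (gridInner M h e e + μ * gridInner M h (dxHalf h e) (dxHalf h e)
      + μ * (h ^ 2 / 18 * gridInner M h f f)) =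
      gridInner M h e e + 18 * gridInner M h (dxHalf h e) (dxHalf h e) + h ^ 2 * gridInner M h f f
      + (18 / μ * gridInner M h e e + μ * gridInner M h (dxHalf h e) (dxHalf h e)
        + μ * (h ^ 2 / 18 * gridInner M h f f)) := by
    field_simp; ring
  rw [this]
  have : 0 ≤ (18 / μ * gridInner M h e e + μ * gridInner M h (dxHalf h e) (dxHalf h e)
        + μ * (h ^ 2 / 18 * gridInner M h f f)) := by positivity
  linarith

theorem gridInner_Psi {M : ℕ} (h : ℝ) {v w e : ℤ → ℝ} (hv : v ∈ gridSpace M)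
    (hw : w ∈ gridSpace M) (he : e ∈ gridSpace M) :
    gridInner M h (Psi h v w) e = (1 / 3) * (gridInner M h (fun p => v p * dxCentral h w p) e
      - gridInner M h (fun p => v p * w p) (dxCentral h e)) := by
  have h1 := gridInner_dxCentral h (v := fun p => v p * w p) (w := e)
    (fun p => by simp only [hv p, hw p]) he
  have h2 : gridInner M h (Psi h v w) e
      = (1 / 3) * (gridInner M h (fun p => v p * dxCentral h w p) e
      + gridInner M h (dxCentral h (fun p => v p * w p)) e) := by
    simp only [gridInner, Psi, ← mul_add, ← Finset.sum_add_distrib]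
    rw [mul_left_comm (1 / 3 : ℝ) h, Finset.mul_sum _ _ (1 / 3 : ℝ)]
    congr 1
    exact Finset.sum_congr rfl fun p _ => by ring
  rw [h2, h1]; ring

/-- The weights in `Psi` make `Psi h v` a skew-symmetric operator, whatever the coefficient `v` is.
-/
theorem gridInner_Psi_self {M : ℕ} (h : ℝ) {v e : ℤ → ℝ} (hv : v ∈ gridSpace M)
    (he : e ∈ gridSpace M) : gridInner M h (Psi h v e) e = 0 := by
  rw [gridInner_Psi h hv he he]
  have : gridInner M h (fun p => v p * dxCentral h e p) e
      = gridInner M h (fun p => v p * e p) (dxCentral h e) := by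
    simp only [gridInner]
    congr 1
    exact Finset.sum_congr rfl fun p _ => by ring
  rw [this]; ring

theorem abs_gridInner_mul_le (M : ℕ) {h : ℝ} (hh : 0 < h) {v g w : ℤ → ℝ} {K : ℝ}
    (hg : ∀ p, |g p| ≤ K) :
    |gridInner M h (fun p => v p * g p) w| ≤ K / 2 * (gridInner M h v v + gridInner M h w w) := by
  have hab : ∀ p, |v p * g p * w p| ≤ K / 2 * (v p * v p) + K / 2 * (w p * w p) := fun p => by
    have h1 : |v p * w p| ≤ (v p * v p + w p * w p) / 2 := by
      rw [abs_le]; constructor <;> nlinarith [sq_nonneg (v p - w p), sq_nonneg (v p + w p)]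
    calc |v p * g p * w p| = |g p| * |v p * w p| := by rw [← abs_mul]; congr 1; ring
      _ ≤ K * ((v p * v p + w p * w p) / 2) :=
        mul_le_mul (hg p) h1 (abs_nonneg _) ((abs_nonneg _).trans (hg p))
      _ = _ := by ring
  have hs : h * ∑ p ∈ Finset.Icc (1 : ℤ) M, (K / 2 * (v p * v p) + K / 2 * (w p * w p))
      = K / 2 * (gridInner M h v v + gridInner M h w w) := by
    rw [Finset.sum_add_distrib, ← Finset.mul_sum, ← Finset.mul_sum]; simp only [gridInner]; ring
  rw [← hs, gridInner, abs_mul, abs_of_pos hh]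
  exact mul_le_mul_of_nonneg_left ((Finset.abs_sum_le_sum_abs _ _).trans
    (Finset.sum_le_sum fun p _ => hab p)) hh.le

/-- Summation by parts puts every difference on `w` or `e`, none on `v`. This matters for `v` a mean
of `f`, which the energy controls only through `h²‖f‖²`. -/
theorem abs_gridInner_Psi_le {M : ℕ} {h : ℝ} (hh : 0 < h) {v w e : ℤ → ℝ} {K : ℝ}
    (hv : v ∈ gridSpace M) (hw : w ∈ gridSpace M) (he : e ∈ gridSpace M)
    (hwK : ∀ p, |w p| ≤ K) (hdK : ∀ p, |dxCentral h w p| ≤ K) :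
    |gridInner M h (Psi h v w) e| ≤ K * (gridInner M h v v + gridInner M h e e
      + gridInner M h (dxHalf h e) (dxHalf h e)) := by
  have hK : 0 ≤ K := (abs_nonneg _).trans (hwK 0)
  have h1 := abs_le.1 (abs_gridInner_mul_le M hh (v := v) (w := e) hdK)
  have h2 := abs_le.1 (abs_gridInner_mul_le M hh (v := v) (w := dxCentral h e) hwK)
  have h3 := mul_le_mul_of_nonneg_left (gridInner_dxCentral_self_le hh he) hK
  have n1 := mul_nonneg hK (gridInner_self_nonneg M hh v)
  have n2 := mul_nonneg hK (gridInner_self_nonneg M hh e)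
  have n3 := mul_nonneg hK (gridInner_self_nonneg M hh (dxHalf h e))
  rw [gridInner_Psi h hv hw he, abs_le]
  constructor <;> linarith

end BBMB

/-! ### The energy estimate over one time step and its summation. -/

namespace BBMB

/-- The average of two grid functions. -/
noncomputable def gridMean (v w : ℤ → ℝ) (p : ℤ) : ℝ := (v p + w p) / 2

theorem gridMean_mem {M : ℕ} {v w : ℤ → ℝ} (hv : v ∈ gridSpace M) (hw : w ∈ gridSpace M) :
    gridMean v w ∈ gridSpace M := fun p => by simp only [gridMean, hv p, hw p]

theorem IsCompactLaplacian.gridMean {M : ℕ} {h : ℝ} {e f e' f' : ℤ → ℝ}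
    (H : IsCompactLaplacian M h e f) (H' : IsCompactLaplacian M h e' f') :
    IsCompactLaplacian M h (gridMean e e') (gridMean f f') := fun p h1 h2 => by
  have a1 := H p h1 h2
  have a2 := H' p h1 h2
  simp only [dxx, dxHalf, BBMB.gridMean] at *
  linear_combination (a1 + a2) / 2

theorem gridInner_mean_self_le (M : ℕ) {h : ℝ} (hh : 0 < h) (v w : ℤ → ℝ) :
    gridInner M h (gridMean v w) (gridMean v w) ≤ (gridInner M h v v + gridInner M h w w) / 2 := by
  have h2 := gridSum_le M hh (f := fun p => gridMean v w p * gridMean v w p)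
    (g := fun p => v p * v p / 2 + w p * w p / 2)
    (fun p _ _ => by simp only [gridMean]; nlinarith [sq_nonneg (v p - w p)])
  rw [Finset.sum_add_distrib, ← Finset.sum_div, ← Finset.sum_div] at h2
  simp only [gridInner]
  linarith

theorem dxHalf_gridMean (h : ℝ) (v w : ℤ → ℝ) :
    dxHalf h (gridMean v w) = gridMean (dxHalf h v) (dxHalf h w) := by
  funext p; simp only [dxHalf, gridMean]; ring

theorem energy_identity {μ lam h τ : ℝ} {M : ℕ} {e0 e1 f0 f1 U v w R : ℤ → ℝ} (hτ : 0 < τ)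
    (he0 : e0 ∈ gridSpace M) (he1 : e1 ∈ gridSpace M)
    (hf0 : f0 ∈ gridSpace M) (hf1 : f1 ∈ gridSpace M)
    (hv : v ∈ gridSpace M) (hw : w ∈ gridSpace M)
    (H0 : IsCompactLaplacian M h e0 f0) (H1 : IsCompactLaplacian M h e1 f1)
    (hR : ∀ p : ℤ, 1 ≤ p → p ≤ M →
      (e1 p - e0 p) / τ - μ * ((f1 p - f0 p) / τ)
        + (Psi h (gridMean e1 e0) U p + Psi h v (gridMean e1 e0) p)
        - h ^ 2 / 2 * (Psi h (gridMean f1 f0) U p + Psi h w (gridMean e1 e0) p)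
        + dxCentral h (gridMean e1 e0) p - h ^ 2 / 6 * dxCentral h (gridMean f1 f0) p
        - lam * gridMean f1 f0 p = R p) :
    (gridEnergy μ M h e1 f1 - gridEnergy μ M h e0 f0) / (2 * τ) =
      gridInner M h R (gridMean e1 e0)
      - gridInner M h (Psi h (gridMean e1 e0) U) (gridMean e1 e0)
      + h ^ 2 / 2 * gridInner M h (Psi h (gridMean f1 f0) U) (gridMean e1 e0)
      - h ^ 2 / 6 * gridInner M h (gridMean f1 f0) (dxCentral h (gridMean e1 e0))
      + lam * gridInner M h (gridMean f1 f0) (gridMean e1 e0) := by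
  -- The symmetry `s` cancels the cross terms `(f1, e0)` and `(f0, e1)`, so the `μ` part becomes an
  -- exact time difference. `z1`, `z2`, `z3` are the terms that vanish by skew symmetry.
  have hE := gridMean_mem he1 he0
  have hF := gridMean_mem hf1 hf0
  have s := H1.gridInner_symm he1 hf1 he0 hf0 H0
  have z1 := gridInner_Psi_self h hv hE
  have z2 := gridInner_Psi_self h hw hE
  have z3 := gridInner_dxCentral h hE hE
  rw [gridInner_comm M h (gridMean e1 e0) (dxCentral h (gridMean e1 e0))] at z3
  have z4 := gridInner_dxCentral h hF hE
  have key := gridSum_congr M (h := h) (f := fun p => R p * gridMean e1 e0 p)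
    (g := fun p => 1 / (2 * τ) * (e1 p * e1 p) - 1 / (2 * τ) * (e0 p * e0 p)
      - μ / (2 * τ) * (f1 p * e1 p) - μ / (2 * τ) * (f1 p * e0 p)
      + μ / (2 * τ) * (f0 p * e1 p) + μ / (2 * τ) * (f0 p * e0 p)
      + Psi h (gridMean e1 e0) U p * gridMean e1 e0 p
      + Psi h v (gridMean e1 e0) p * gridMean e1 e0 p
      - h ^ 2 / 2 * (Psi h (gridMean f1 f0) U p * gridMean e1 e0 p)
      - h ^ 2 / 2 * (Psi h w (gridMean e1 e0) p * gridMean e1 e0 p)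
      + dxCentral h (gridMean e1 e0) p * gridMean e1 e0 p
      - h ^ 2 / 6 * (dxCentral h (gridMean f1 f0) p * gridMean e1 e0 p)
      - lam * (gridMean f1 f0 p * gridMean e1 e0 p))
    (fun p h1 h2 => by
      rw [← hR p h1 h2]
      have : gridMean e1 e0 p = (e1 p + e0 p) / 2 := rfl
      have t : (e1 p - e0 p) / τ * gridMean e1 e0 p =
        1 / (2 * τ) * (e1 p * e1 p) - 1 / (2 * τ) * (e0 p * e0 p) := by
        rw [this]; field_simp; ring
      have t' : μ * ((f1 p - f0 p) / τ) * gridMean e1 e0 p =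
        μ / (2 * τ) * (f1 p * e1 p) + μ / (2 * τ) * (f1 p * e0 p)
        - μ / (2 * τ) * (f0 p * e1 p) - μ / (2 * τ) * (f0 p * e0 p) := by
        rw [this]; field_simp; ring
      linear_combination t - t')
  simp only [Finset.sum_add_distrib, Finset.sum_sub_distrib, ← Finset.mul_sum] at key
  simp only [gridEnergy]
  simp only [gridInner] at *
  rw [key]
  have e : ∀ a b c d : ℝ, (a - μ * b - (c - μ * d)) / (2 * τ) =
    1 / (2 * τ) * a - 1 / (2 * τ) * c - μ / (2 * τ) * b + μ / (2 * τ) * d := fun a b c d => by ring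
  rw [e]
  linear_combination μ / (2 * τ) * s - z1 + h ^ 2 / 2 * z2 - z3 / 2 + h ^ 2 / 6 * z4

/-- For the mean errors `E`, `F`, read `a = ‖E‖²`, `b = |E|₁²`, `c = ‖F‖²`, `η = h²`, `l = L²`; `p0`
is the dissipation, `p1` and `p2` the products with `U`, `p3` the term `(F, ΔₓE)`, `p4` the residual
term. The factor `η` always stays with `c`, since only `h²‖F‖²` is controlled by the energy. -/
theorem energy_terms_le {K l η a b c r p0 p1 p2 p3 p4 : ℝ} (hK : 0 ≤ K) (hη : 0 ≤ η) (hl : η ≤ l)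
    (ha : 0 ≤ a) (hb : 0 ≤ b) (hc : 0 ≤ c) (h0 : p0 ≤ 0) (h1 : -(K * (a + a + b)) ≤ p1)
    (h2 : p2 ≤ K * (c + a + b)) (h3 : -(1 / 2 * (c + b)) ≤ p3) (h4 : p4 ≤ 1 / 2 * (r + a)) :
    p4 - p1 + η / 2 * p2 - η / 6 * p3 + p0 ≤ (K + 1) * (l + 2) * (a + b + η * c) + r / 2 := by
  have hl0 : 0 ≤ l := hη.trans hl
  have t2 := mul_le_mul_of_nonneg_left h2 (show 0 ≤ η / 2 by positivity)
  have t3 := mul_le_mul_of_nonneg_left h3 (show 0 ≤ η / 6 by positivity)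
  have s1 := mul_le_mul_of_nonneg_right hl (show 0 ≤ K * (a + b) by positivity)
  have s2 := mul_le_mul_of_nonneg_right hl hb
  have n1 : 0 ≤ K * (l * a) := by positivity
  have n2 : 0 ≤ K * (l * b) := by positivity
  have n3 : 0 ≤ K * (l * (η * c)) := by positivity
  have n4 : 0 ≤ K * (η * c) := by positivity
  have n5 : 0 ≤ l * (η * c) := by positivity
  have n6 : 0 ≤ η * c := by positivity
  have n7 : 0 ≤ K * a := by positivity
  have n8 : 0 ≤ K * b := by positivity
  have n9 : 0 ≤ l * a := by positivity
  have n10 : 0 ≤ l * b := by positivity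
  linarith

theorem energy_step {μ lam L h τ K ρ : ℝ} {M : ℕ} {e0 e1 f0 f1 U v w R : ℤ → ℝ}
    (hμ : 0 < μ) (hlam : 0 < lam) (hh : 0 < h) (hhL : h ≤ L) (hτ : 0 < τ)
    (he0 : e0 ∈ gridSpace M) (he1 : e1 ∈ gridSpace M)
    (hf0 : f0 ∈ gridSpace M) (hf1 : f1 ∈ gridSpace M)
    (hU : U ∈ gridSpace M) (hv : v ∈ gridSpace M) (hw : w ∈ gridSpace M)
    (H0 : IsCompactLaplacian M h e0 f0) (H1 : IsCompactLaplacian M h e1 f1)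
    (hUK : ∀ p, |U p| ≤ K) (hdK : ∀ p, |dxCentral h U p| ≤ K)
    (hR : ∀ p : ℤ, 1 ≤ p → p ≤ M →
      (e1 p - e0 p) / τ - μ * ((f1 p - f0 p) / τ)
        + (Psi h (gridMean e1 e0) U p + Psi h v (gridMean e1 e0) p)
        - h ^ 2 / 2 * (Psi h (gridMean f1 f0) U p + Psi h w (gridMean e1 e0) p)
        + dxCentral h (gridMean e1 e0) p - h ^ 2 / 6 * dxCentral h (gridMean f1 f0) p
        - lam * gridMean f1 f0 p = R p)
    (hRρ : ∀ p : ℤ, 1 ≤ p → p ≤ M → |R p| ≤ ρ) :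
    gridEnergy μ M h e1 f1 ≤ gridEnergy μ M h e0 f0
      + τ * ((K + 1) * (L ^ 2 + 2) * (1 + 18 / μ)
          * (gridEnergy μ M h e1 f1 + gridEnergy μ M h e0 f0) + h * M * ρ ^ 2) := by
  have key := energy_identity hτ he0 he1 hf0 hf1 hv hw H0 H1 hR
  have hE := gridMean_mem he1 he0
  have hF := gridMean_mem hf1 hf0
  have hK : 0 ≤ K := (abs_nonneg _).trans (hUK 0)
  have H := H1.gridMean H0
  have b0 : lam * gridInner M h (gridMean f1 f0) (gridMean e1 e0) ≤ 0 := by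
    have := H.le_neg_gridInner hh hE hF
    have n2 := gridInner_self_nonneg M hh (dxHalf h (gridMean e1 e0))
    have n3 := mul_nonneg (show 0 ≤ h ^ 2 / 18 by positivity)
      (gridInner_self_nonneg M hh (gridMean f1 f0))
    exact mul_nonpos_of_nonneg_of_nonpos hlam.le (by linarith)
  have b1 := (abs_le.1 (abs_gridInner_Psi_le hh hE hU hE hUK hdK)).1
  have b2 := (abs_le.1 (abs_gridInner_Psi_le hh hF hU hE hUK hdK)).2
  -- With the weight `1` the bound is Young's inequality for the inner product.
  have b3 := (abs_le.1 (abs_gridInner_mul_le M hh (v := gridMean f1 f0) (g := fun _ => 1)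
    (w := dxCentral h (gridMean e1 e0)) (K := 1) (fun _ => by simp))).1
  simp only [mul_one] at b3
  have b3' := gridInner_dxCentral_self_le hh hE
  have b4 := (abs_le.1 (abs_gridInner_mul_le M hh (v := R) (g := fun _ => 1)
    (w := gridMean e1 e0) (K := 1) (fun _ => by simp))).2
  simp only [mul_one] at b4
  have b5 : gridInner M h R R ≤ h * M * ρ ^ 2 := by
    have := gridSum_le M hh (f := fun p => R p * R p) (g := fun _ => ρ ^ 2) (fun p h1 h2 => by
      have := hRρ p h1 h2
      calc R p * R p = |R p| ^ 2 := by rw [sq_abs]; ring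
        _ ≤ ρ ^ 2 := pow_le_pow_left₀ (abs_nonneg _) this 2)
    simp only [Finset.sum_const, Int.card_Icc, nsmul_eq_mul] at this
    simp only [gridInner]
    simp at this
    linarith
  have c1 := sum_norms_le_gridEnergy hμ hh he1 hf1 H1
  have c0 := sum_norms_le_gridEnergy hμ hh he0 hf0 H0
  have m1 := gridInner_mean_self_le M hh e1 e0
  have m2 := gridInner_mean_self_le M hh (dxHalf h e1) (dxHalf h e0)
  rw [← dxHalf_gridMean] at m2
  have m3 := gridInner_mean_self_le M hh f1 f0
  have na := gridInner_self_nonneg M hh (gridMean e1 e0)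
  have nb := gridInner_self_nonneg M hh (dxHalf h (gridMean e1 e0))
  have nc := gridInner_self_nonneg M hh (gridMean f1 f0)
  have hL2 : h ^ 2 ≤ L ^ 2 := pow_le_pow_left₀ hh.le hhL 2
  have m3' := mul_le_mul_of_nonneg_left m3 (sq_nonneg h)
  have hN : gridInner M h (gridMean e1 e0) (gridMean e1 e0)
      + gridInner M h (dxHalf h (gridMean e1 e0)) (dxHalf h (gridMean e1 e0))
      + h ^ 2 * gridInner M h (gridMean f1 f0) (gridMean f1 f0)
      ≤ (1 + 18 / μ) * (gridEnergy μ M h e1 f1 + gridEnergy μ M h e0 f0) / 2 := by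
    linarith
  have hfin := energy_terms_le (p4 := gridInner M h R (gridMean e1 e0)) (r := h * M * ρ ^ 2)
    hK (sq_nonneg h) hL2 na nb nc b0 b1 b2 (le_trans (by linarith) b3) (b4.trans (by linarith))
  rw [← key] at hfin
  rw [div_le_iff₀ (by positivity)] at hfin
  have hN' := mul_le_mul_of_nonneg_left hN (show 0 ≤ 2 * τ * ((K + 1) * (L ^ 2 + 2)) by positivity)
  linarith

/-- A discrete Grönwall inequality. -/
theorem discrete_gronwall {F : ℕ → ℝ} {N : ℕ} {τ κ b : ℝ} (hτ : 0 ≤ τ) (hκ : 0 ≤ κ) (hb : 0 ≤ b)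
    (hκτ : 2 * (κ * τ) ≤ 1) (h0 : F 0 = 0) (hF : ∀ q ≤ N, 0 ≤ F q)
    (hstep : ∀ q < N, F (q + 1) ≤ F q + τ * (κ * (F (q + 1) + F q) + b)) :
    ∀ q ≤ N, F q ≤ 2 * b * (N * τ) * Real.exp (4 * κ * (N * τ)) := by
  have claim : ∀ q ≤ N, F q ≤ q * (2 * τ * b) * (1 + 4 * κ * τ) ^ q := by
    intro q
    induction q with
    | zero => intro _; simp [h0]
    | succ n ih =>
      intro hn
      have h1 := ih (by omega)
      have h2 := hstep n (by omega)
      have f1 := hF (n + 1) hn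
      have f0 := hF n (by omega)
      have k0 : 0 ≤ κ * τ := by positivity
      -- With `x = κτ ≤ 1/2` one has `1 + x ≤ (1 - x)(1 + 4x)` and `1 ≤ 2(1 - x)`, which makes the
      -- implicit step explicit.
      have hs : F (n + 1) ≤ (1 + 4 * κ * τ) * F n + 2 * τ * b := by
        have e1 : (1 - κ * τ) * F (n + 1) ≤ (1 + κ * τ) * F n + τ * b := by linarith
        have e2 : (1 + κ * τ) * F n + τ * b ≤
            (1 - κ * τ) * ((1 + 4 * κ * τ) * F n + 2 * τ * b) := by
          have p1 : 0 ≤ (1 - 2 * (κ * τ)) * (κ * τ * F n) := by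
            apply mul_nonneg (by linarith); positivity
          have p2 : 0 ≤ (1 - 2 * (κ * τ)) * (τ * b) := mul_nonneg (by linarith) (by positivity)
          linarith
        exact le_of_mul_le_mul_left (e1.trans e2) (by linarith)
      have hg : 1 ≤ 1 + 4 * κ * τ := by nlinarith
      have hp : 1 ≤ (1 + 4 * κ * τ) ^ (n + 1) := one_le_pow₀ hg
      have h3 := mul_le_mul_of_nonneg_left h1 (show 0 ≤ 1 + 4 * κ * τ by linarith)
      have h4 := mul_le_mul_of_nonneg_left hp (show 0 ≤ 2 * τ * b by positivity)
      calc F (n + 1) ≤ (1 + 4 * κ * τ) * F n + 2 * τ * b := hs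
        _ ≤ (1 + 4 * κ * τ) * (n * (2 * τ * b) * (1 + 4 * κ * τ) ^ n)
            + 2 * τ * b * (1 + 4 * κ * τ) ^ (n + 1) := by linarith
        _ = _ := by push_cast; ring
  intro q hq
  refine (claim q hq).trans ?_
  have hqN : (q : ℝ) ≤ N := by exact_mod_cast hq
  have hk : 0 ≤ 4 * κ * τ := by positivity
  have h1 : (1 + 4 * κ * τ) ^ q ≤ Real.exp (4 * κ * (N * τ)) := by
    calc (1 + 4 * κ * τ) ^ q ≤ (Real.exp (4 * κ * τ)) ^ q :=
          pow_le_pow_left₀ (by linarith) (by linarith [Real.add_one_le_exp (4 * κ * τ)]) q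
      _ = Real.exp (q * (4 * κ * τ)) := (Real.exp_nat_mul _ q).symm
      _ ≤ _ := Real.exp_le_exp.2 (by nlinarith)
  have h2 : (q : ℝ) * (2 * τ * b) ≤ 2 * b * (N * τ) := by
    have : 0 ≤ 2 * τ * b := by positivity
    nlinarith
  exact mul_le_mul h2 h1 (by positivity) (by positivity)

/-! ### Solvability and stability of the compact averaging operator. -/

theorem exists_compact_inverse {M : ℕ} (hM : 1 ≤ M) {g : ℤ → ℝ} (hg : g ∈ gridSpace M) :
    ∃ s ∈ gridSpace M, ∀ p, s p + (s (p + 1) - 2 * s p + s (p - 1)) / 12 = g p := by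
  have : NeZero M := ⟨by omega⟩
  -- On `ZMod M` periodicity is built in and the space is finite dimensional, so injectivity
  -- suffices. It follows at a maximum of `|s|` from diagonal dominance, `10` against `1 + 1`.
  let A : (ZMod M → ℝ) →ₗ[ℝ] (ZMod M → ℝ) :=
    { toFun := fun s k => s k + (s (k + 1) - 2 * s k + s (k - 1)) / 12
      map_add' := fun s t => by funext k; simp only [Pi.add_apply]; ring
      map_smul' := fun c s => by
        funext k; simp only [Pi.smul_apply, smul_eq_mul, RingHom.id_apply]; ring }
  have hA : Function.Injective A := by
    rw [injective_iff_map_eq_zero]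
    intro s hs
    obtain ⟨k, hk⟩ := Finite.exists_max (fun k => |s k|)
    have h0 : s k + (s (k + 1) - 2 * s k + s (k - 1)) / 12 = 0 := congrFun hs k
    have h1 := hk (k + 1)
    have h2 := hk (k - 1)
    have h3 : |s k| ≤ 0 := by
      have e : 10 * s k = -(s (k + 1)) - s (k - 1) := by linarith
      have : 10 * |s k| ≤ |s (k + 1)| + |s (k - 1)| := by
        rw [← abs_of_pos (show (0 : ℝ) < 10 by norm_num), ← abs_mul, e]
        exact (abs_sub _ _).trans (by rw [abs_neg])
      linarith
    funext j
    have := (hk j).trans h3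
    simpa using this
  obtain ⟨s, hs⟩ := LinearMap.injective_iff_surjective.1 hA
    (fun k : ZMod M => g (k.val : ℤ))
  have hg' : ∀ p : ℤ, g (((p : ZMod M).val : ℕ) : ℤ) = g p := by
    intro p
    rw [ZMod.val_intCast]
    have hper : Function.Periodic g (M : ℤ) := hg
    conv_rhs => rw [← Int.emod_add_mul_ediv p M, mul_comm]
    exact (hper.int_mul (p / M) (p % M)).symm
  refine ⟨fun p => s (p : ZMod M), fun p => by simp, fun p => ?_⟩
  have := congrFun hs (p : ZMod M)
  rw [hg' p] at this
  rw [← this]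
  simp [A]

/-- Maximum principle: where `|s|` is largest, `10|s| ≤ 12B + 2|s|`. -/
theorem abs_le_of_compact {M : ℕ} (hM : 1 ≤ M) {s g : ℤ → ℝ} {B : ℝ} (hs : s ∈ gridSpace M)
    (hsg : ∀ p, s p + (s (p + 1) - 2 * s p + s (p - 1)) / 12 = g p) (hB : ∀ p, |g p| ≤ B) (p : ℤ) :
    |s p| ≤ 3 / 2 * B := by
  have hper : Function.Periodic s (M : ℤ) := hs
  obtain ⟨k, -, hk⟩ := Finset.exists_max_image (Finset.Ico (0 : ℤ) M) (fun p => |s p|)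
    ⟨0, by simp; omega⟩
  have hmax : ∀ p, |s p| ≤ |s k| := by
    intro p
    have e : s p = s (p % M) := by
      conv_lhs => rw [← Int.emod_add_mul_ediv p M, mul_comm]
      exact hper.int_mul (p / M) (p % M)
    rw [e]
    exact hk _ (Finset.mem_Ico.2 ⟨Int.emod_nonneg _ (by omega), Int.emod_lt_of_pos _ (by omega)⟩)
  refine (hmax p).trans ?_
  have h1 := hmax (k + 1)
  have h2 := hmax (k - 1)
  have e : 10 * s k = 12 * g k - s (k + 1) - s (k - 1) := by linarith [hsg k]
  have : 10 * |s k| ≤ 12 * |g k| + |s (k + 1)| + |s (k - 1)| := by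
    calc 10 * |s k| = |10 * s k| := by rw [abs_mul]; norm_num
      _ = |12 * g k - s (k + 1) - s (k - 1)| := by rw [e]
      _ ≤ |12 * g k - s (k + 1)| + |s (k - 1)| := abs_sub _ _
      _ ≤ |12 * g k| + |s (k + 1)| + |s (k - 1)| := by gcongr; exact abs_sub _ _
      _ = _ := by rw [abs_mul]; norm_num
  linarith [hB k]

end BBMB

/-! ### Taylor expansion and the order of the difference quotients. -/

namespace BBMB

/-- The derivative of a Taylor remainder is the remainder of the derivative, one order lower, so the
mean value inequality gives the induction. The factor `1 / n!` is given up. Derivatives within `s`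
allow the closed time interval. -/
theorem abs_sub_taylor_le {s : Set ℝ} (hs : Convex ℝ s) {K : ℝ} (n : ℕ) :
    ∀ v : ℕ → ℝ → ℝ, (∀ k < n, ∀ x ∈ s, HasDerivWithinAt (v k) (v (k + 1) x) s x) →
      (∀ x ∈ s, |v n x| ≤ K) → ∀ x ∈ s, ∀ y ∈ s,
      |v 0 y - ∑ k ∈ Finset.range n, v k x * ((y - x) ^ k / k.factorial)| ≤ K * |y - x| ^ n := by
  induction n with
  | zero => intro v _ hK x _ y hy; simpa using hK y hy
  | succ n ih =>
    intro v hv hK x hx y hy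
    have ih' := ih (fun k => v (k + 1)) (fun k hk => hv (k + 1) (by omega)) hK x hx
    have hK0 : 0 ≤ K := (abs_nonneg _).trans (hK x hx)
    have hsub : uIcc x y ⊆ s := hs.ordConnected.uIcc_subset hx hy
    set g : ℝ → ℝ := fun z =>
      v 0 z - ∑ k ∈ Finset.range (n + 1), v k x * ((z - x) ^ k / k.factorial) with hg
    have hd : ∀ z ∈ uIcc x y, HasDerivWithinAt g
        (v 1 z - ∑ k ∈ Finset.range n, v (k + 1) x * ((z - x) ^ k / k.factorial)) (uIcc x y) z := by
      intro z hz
      have h0 := (hv 0 (by omega) z (hsub hz)).mono hsub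
      refine h0.sub ?_
      have h1 : HasDerivAt (fun z => ∑ k ∈ Finset.range n,
          v (k + 1) x * ((z - x) ^ (k + 1) / (k + 1).factorial) + v 0 x)
          (∑ k ∈ Finset.range n, v (k + 1) x * ((z - x) ^ k / k.factorial)) z := by
        refine HasDerivAt.add_const _ (HasDerivAt.fun_sum fun k _ => HasDerivAt.const_mul _ ?_)
        have hp : HasDerivAt (fun z => (z - x) ^ (k + 1)) ((k + 1 : ℕ) * (z - x) ^ k) z := by
          simpa using ((hasDerivAt_id z).sub_const x).fun_pow (k + 1)
        refine (hp.div_const _).congr_deriv ?_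
        rw [Nat.factorial_succ]
        push_cast
        have : ((k : ℝ) + 1) ≠ 0 := by positivity
        have : ((k.factorial : ℕ) : ℝ) ≠ 0 := by positivity
        field_simp
      have h2 : (fun z => ∑ k ∈ Finset.range (n + 1), v k x * ((z - x) ^ k / k.factorial))
          = fun z => ∑ k ∈ Finset.range n,
            v (k + 1) x * ((z - x) ^ (k + 1) / (k + 1).factorial) + v 0 x :=
        funext fun z => by rw [Finset.sum_range_succ']; simp
      rw [h2]
      exact h1.hasDerivWithinAt
    have hb : ∀ z ∈ uIcc x y,
        ‖v 1 z - ∑ k ∈ Finset.range n, v (k + 1) x * ((z - x) ^ k / k.factorial)‖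
          ≤ K * |y - x| ^ n := by
      intro z hz
      refine (ih' z (hsub hz)).trans (mul_le_mul_of_nonneg_left ?_ hK0)
      refine pow_le_pow_left₀ (abs_nonneg _) ?_ n
      exact abs_sub_left_of_mem_uIcc hz
    have := (convex_uIcc x y).norm_image_sub_le_of_norm_hasDerivWithin_le hd hb
      left_mem_uIcc right_mem_uIcc
    have gx : g x = 0 := by
      simp only [hg]
      rw [Finset.sum_range_succ', Finset.sum_eq_zero]
      · simp
      · intro k _; simp
    rw [gx, sub_zero, Real.norm_eq_abs, Real.norm_eq_abs] at this
    rw [pow_succ, ← mul_assoc]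
    exact this

/-- `v 0, …, v n` are successive derivatives of a function on the line. -/
def IsDerivChain (n : ℕ) (v : ℕ → ℝ → ℝ) : Prop :=
  ∀ k < n, ∀ x, HasDerivAt (v k) (v (k + 1) x) x

theorem IsDerivChain.taylor {n : ℕ} {v : ℕ → ℝ → ℝ} (hv : IsDerivChain n v) {K : ℝ}
    (hK : ∀ x, |v n x| ≤ K) (x y : ℝ) :
    |v 0 (x + y) - ∑ k ∈ Finset.range n, v k x * (y ^ k / k.factorial)| ≤ K * |y| ^ n := by
  have := abs_sub_taylor_le convex_univ n v (fun k hk x _ => (hv k hk x).hasDerivWithinAt)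
    (fun x _ => hK x) x (mem_univ _) (x + y) (mem_univ _)
  simpa using this

theorem IsDerivChain.mono {n m : ℕ} (hmn : m ≤ n) {v : ℕ → ℝ → ℝ} (hv : IsDerivChain n v) :
    IsDerivChain m v := fun k hk => hv k (hk.trans_le hmn)

theorem IsDerivChain.shift {n m : ℕ} {v : ℕ → ℝ → ℝ} (hv : IsDerivChain (n + m) v) :
    IsDerivChain n (fun k => v (k + m)) := fun k hk x => by
  have := hv (k + m) (by omega) x
  rwa [show k + m + 1 = k + 1 + m by ring] at this

/-- The restriction of a function to the grid `a + p h`. -/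
def gridRestrict (a h : ℝ) (v : ℝ → ℝ) (p : ℤ) : ℝ := v (a + p * h)

theorem gridRestrict_succ (a h : ℝ) (v : ℝ → ℝ) (p : ℤ) :
    gridRestrict a h v (p + 1) = v (a + p * h + h) := by
  simp only [gridRestrict]; push_cast; congr 1; ring

theorem gridRestrict_pred (a h : ℝ) (v : ℝ → ℝ) (p : ℤ) :
    gridRestrict a h v (p - 1) = v (a + p * h + -h) := by
  simp only [gridRestrict]; push_cast; congr 1; ring

theorem dxCentral_gridRestrict_le {a h : ℝ} (hh : 0 < h) {v : ℕ → ℝ → ℝ} {K : ℝ}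
    (hv : IsDerivChain 1 v) (hK : ∀ x, |v 1 x| ≤ K) (p : ℤ) :
    |dxCentral h (gridRestrict a h (v 0)) p| ≤ K := by
  have h1 := hv.taylor hK (a + p * h) h
  have h2 := hv.taylor hK (a + p * h) (-h)
  rw [abs_neg] at h2
  simp only [Finset.sum_range_succ, Finset.sum_range_zero, abs_of_pos hh] at h1 h2
  norm_num at h1 h2
  rw [abs_le] at h1 h2
  simp only [dxCentral, gridRestrict_succ, gridRestrict_pred]
  rw [abs_div, abs_of_pos (show 0 < 2 * h by positivity), div_le_iff₀ (by positivity), abs_le]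
  constructor <;> linarith

theorem dxCentral_gridRestrict_second_order {a h : ℝ} (hh : 0 < h) {v : ℕ → ℝ → ℝ} {K : ℝ}
    (hv : IsDerivChain 3 v) (hK : ∀ x, |v 3 x| ≤ K) (p : ℤ) :
    |dxCentral h (gridRestrict a h (v 0)) p - v 1 (a + p * h)| ≤ K * h ^ 2 := by
  have h1 := hv.taylor hK (a + p * h) h
  have h2 := hv.taylor hK (a + p * h) (-h)
  rw [abs_neg] at h2
  simp only [Finset.sum_range_succ, Finset.sum_range_zero, abs_of_pos hh] at h1 h2
  norm_num [Nat.factorial] at h1 h2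
  rw [abs_le] at h1 h2
  simp only [dxCentral, gridRestrict_succ, gridRestrict_pred]
  rw [div_sub' (by positivity), abs_div, abs_of_pos (show 0 < 2 * h by positivity),
    div_le_iff₀ (by positivity), abs_le]
  constructor <;> linarith

theorem dxCentral_gridRestrict_fourth_order {a h : ℝ} (hh : 0 < h) {v : ℕ → ℝ → ℝ} {K : ℝ}
    (hv : IsDerivChain 5 v) (hK : ∀ x, |v 5 x| ≤ K) (p : ℤ) :
    |dxCentral h (gridRestrict a h (v 0)) p - v 1 (a + p * h) - h ^ 2 / 6 * v 3 (a + p * h)|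
      ≤ K * h ^ 4 := by
  have h1 := hv.taylor hK (a + p * h) h
  have h2 := hv.taylor hK (a + p * h) (-h)
  rw [abs_neg] at h2
  simp only [Finset.sum_range_succ, Finset.sum_range_zero, abs_of_pos hh] at h1 h2
  norm_num [Nat.factorial] at h1 h2
  rw [abs_le] at h1 h2
  simp only [dxCentral, gridRestrict_succ, gridRestrict_pred]
  rw [sub_sub, div_sub' (by positivity), abs_div, abs_of_pos (show 0 < 2 * h by positivity),
    div_le_iff₀ (by positivity), abs_le]
  constructor <;> linarith

/-- The `h²/12 · v 4` error of the second difference is cancelled by the compact correction. The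
remainders add up to `2 + 1/6 ≤ 3` times `K h⁴`. -/
theorem compact_second_difference_le {a h : ℝ} (hh : 0 < h) {v : ℕ → ℝ → ℝ} {K : ℝ}
    (hv : IsDerivChain 6 v) (hK : ∀ x, |v 6 x| ≤ K) (p : ℤ) :
    |dxx h (gridRestrict a h (v 0)) p - h ^ 2 / 12 * dxx h (gridRestrict a h (v 2)) p
      - v 2 (a + p * h)| ≤ 3 * K * h ^ 4 := by
  have h1 := hv.taylor hK (a + p * h) h
  have h2 := hv.taylor hK (a + p * h) (-h)
  have h3 := (hv.shift (n := 4) (m := 2)).taylor hK (a + p * h) h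
  have h4 := (hv.shift (n := 4) (m := 2)).taylor hK (a + p * h) (-h)
  rw [abs_neg] at h2 h4
  simp only [Finset.sum_range_succ, Finset.sum_range_zero, abs_of_pos hh] at h1 h2 h3 h4
  norm_num [Nat.factorial] at h1 h2 h3 h4
  rw [abs_le] at h1 h2 h3 h4
  simp only [dxx, dxHalf, add_sub_cancel_right, gridRestrict_succ, gridRestrict_pred]
  simp only [gridRestrict]
  have h3' := mul_le_mul_of_nonneg_left h3.1 (sq_nonneg h)
  have h3'' := mul_le_mul_of_nonneg_left h3.2 (sq_nonneg h)
  have h4' := mul_le_mul_of_nonneg_left h4.1 (sq_nonneg h)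
  have h4'' := mul_le_mul_of_nonneg_left h4.2 (sq_nonneg h)
  set x := a + p * h
  have hK0 : 0 ≤ K * h ^ 6 := mul_nonneg ((abs_nonneg _).trans (hK 0)) (by positivity)
  have e : ((v 0 (x + h) - v 0 x) / h - (v 0 x - v 0 (x + -h)) / h) / h
      - h ^ 2 / 12 * (((v 2 (x + h) - v 2 x) / h - (v 2 x - v 2 (x + -h)) / h) / h) - v 2 x
      = ((v 0 (x + h) - 2 * v 0 x + v 0 (x + -h))
        - h ^ 2 / 12 * (v 2 (x + h) - 2 * v 2 x + v 2 (x + -h)) - h ^ 2 * v 2 x) / h ^ 2 := by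
    field_simp
    ring
  rw [e, abs_div, abs_of_pos (show 0 < h ^ 2 by positivity), div_le_iff₀ (by positivity), abs_le]
  constructor <;> linarith

theorem trapezoid_le {T K τ t : ℝ} {v : ℕ → ℝ → ℝ} (hτ : 0 < τ) (ht : t ∈ Icc 0 T)
    (ht' : t + τ ∈ Icc 0 T)
    (hv : ∀ k < 3, ∀ s ∈ Icc 0 T, HasDerivWithinAt (v k) (v (k + 1) s) (Icc 0 T) s)
    (hK : ∀ s ∈ Icc 0 T, |v 3 s| ≤ K) :
    |(v 0 (t + τ) - v 0 t) / τ - (v 1 (t + τ) + v 1 t) / 2| ≤ 2 * K * τ ^ 2 := by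
  have h1 := abs_sub_taylor_le (convex_Icc 0 T) 3 v hv hK t ht (t + τ) ht'
  have h2 := abs_sub_taylor_le (convex_Icc 0 T) 2 (fun k => v (k + 1))
    (fun k hk => hv (k + 1) (by omega)) hK t ht (t + τ) ht'
  simp only [Finset.sum_range_succ, Finset.sum_range_zero, add_sub_cancel_left,
    abs_of_pos hτ] at h1 h2
  norm_num [Nat.factorial] at h1 h2
  rw [abs_le] at h1 h2
  have h2' := mul_le_mul_of_nonneg_left h2.1 hτ.le
  have h2'' := mul_le_mul_of_nonneg_left h2.2 hτ.le
  have hK0 : 0 ≤ K * τ ^ 3 := mul_nonneg ((abs_nonneg _).trans (hK t ht)) (by positivity)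
  rw [div_sub' (by positivity), abs_div, abs_of_pos hτ, div_le_iff₀ hτ, abs_le]
  constructor <;> linarith

theorem abs_Psi_le {h A B : ℝ} {v w : ℤ → ℝ} (hv : ∀ p, |v p| ≤ A)
    (hdv : ∀ p, |dxCentral h v p| ≤ A) (hw : ∀ p, |w p| ≤ B) (hdw : ∀ p, |dxCentral h w p| ≤ B)
    (p : ℤ) : |Psi h v w p| ≤ A * B := by
  have hA : 0 ≤ A := (abs_nonneg _).trans (hv 0)
  -- Discrete product rule: `Δₓ(vw)_p = v_{p+1} Δₓw_p + Δₓv_p w_{p-1}`.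
  have e : Psi h v w p = (1 / 3) * (v p * dxCentral h w p + v (p + 1) * dxCentral h w p
      + dxCentral h v p * w (p - 1)) := by
    simp only [Psi, dxCentral]; ring
  have m : ∀ {a b : ℝ}, |a| ≤ A → |b| ≤ B → |a * b| ≤ A * B := fun ha hb => by
    rw [abs_mul]; exact mul_le_mul ha hb (abs_nonneg _) hA
  have h1 := abs_le.1 (m (hv p) (hdw p))
  have h2 := abs_le.1 (m (hv (p + 1)) (hdw p))
  have h3 := abs_le.1 (m (hdv p) (hw (p - 1)))
  rw [e, abs_le]
  constructor <;> linarith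

/-- The spatial part of the compact scheme is a fourth order approximation of `u u_x + u_x`. -/
theorem spatial_consistency {a h K : ℝ} (hh : 0 < h) {v : ℕ → ℝ → ℝ} (hv : IsDerivChain 6 v)
    (hK : ∀ k ≤ 6, ∀ x, |v k x| ≤ K) (p : ℤ) :
    |Psi h (gridRestrict a h (v 0)) (gridRestrict a h (v 0)) p
      - h ^ 2 / 2 * Psi h (gridRestrict a h (v 2)) (gridRestrict a h (v 0)) p
      + dxCentral h (gridRestrict a h (v 0)) p - h ^ 2 / 6 * dxCentral h (gridRestrict a h (v 2)) p
      - (v 0 (a + p * h) * v 1 (a + p * h) + v 1 (a + p * h))|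
      ≤ (13 * K ^ 2 + 2 * K) * h ^ 4 := by
  have hK0 : 0 ≤ K := (abs_nonneg _).trans (hK 0 (by norm_num) 0)
  have m : ∀ i j x, i ≤ 6 → j ≤ 6 → |v i x * v j x| ≤ K * K := fun i j x hi hj => by
    rw [abs_mul]; exact mul_le_mul (hK i hi x) (hK j hj x) (abs_nonneg _) hK0
  -- The successive derivatives of `u²` and `u_xx u`; the default branches are the derivatives of
  -- order five and three, where the chains end. The `h²` terms cancel because `Ψ(u,u)` has the `h²`
  -- coefficient `(u u_xxx + 2 u_x u_xx)/6`, which is also that of `h²/2 · Ψ(u_xx,u)`.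
  let sq : ℕ → ℝ → ℝ := fun k x => match k with
    | 0 => v 0 x * v 0 x
    | 1 => 2 * (v 0 x * v 1 x)
    | 2 => 2 * (v 1 x * v 1 x) + 2 * (v 0 x * v 2 x)
    | 3 => 6 * (v 1 x * v 2 x) + 2 * (v 0 x * v 3 x)
    | 4 => 6 * (v 2 x * v 2 x) + 8 * (v 1 x * v 3 x) + 2 * (v 0 x * v 4 x)
    | _ => 20 * (v 2 x * v 3 x) + 10 * (v 1 x * v 4 x) + 2 * (v 0 x * v 5 x)
  let pr : ℕ → ℝ → ℝ := fun k x => match k with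
    | 0 => v 2 x * v 0 x
    | 1 => v 3 x * v 0 x + v 2 x * v 1 x
    | 2 => v 4 x * v 0 x + 2 * (v 3 x * v 1 x) + v 2 x * v 2 x
    | _ => v 5 x * v 0 x + 3 * (v 4 x * v 1 x) + 4 * (v 3 x * v 2 x)
  have d : ∀ i j x, i < 6 → j < 6 → HasDerivAt (fun x => v i x * v j x)
      (v (i + 1) x * v j x + v i x * v (j + 1) x) x := fun i j x hi hj =>
    (hv i hi x).mul (hv j hj x)
  have hsq : IsDerivChain 5 sq := by
    intro k hk x
    interval_cases k <;> simp only [sq]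
    · refine (d 0 0 x (by norm_num) (by norm_num)).congr_deriv (by ring)
    · refine ((d 0 1 x (by norm_num) (by norm_num)).const_mul 2).congr_deriv (by ring)
    · refine (((d 1 1 x (by norm_num) (by norm_num)).const_mul 2).add
        ((d 0 2 x (by norm_num) (by norm_num)).const_mul 2)).congr_deriv (by ring)
    · refine (((d 1 2 x (by norm_num) (by norm_num)).const_mul 6).add
        ((d 0 3 x (by norm_num) (by norm_num)).const_mul 2)).congr_deriv (by ring)
    · refine ((((d 2 2 x (by norm_num) (by norm_num)).const_mul 6).add
        ((d 1 3 x (by norm_num) (by norm_num)).const_mul 8)).add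
        ((d 0 4 x (by norm_num) (by norm_num)).const_mul 2)).congr_deriv (by ring)
  have hpr : IsDerivChain 3 pr := by
    intro k hk x
    interval_cases k <;> simp only [pr]
    · exact d 2 0 x (by norm_num) (by norm_num)
    · refine ((d 3 0 x (by norm_num) (by norm_num)).add
        (d 2 1 x (by norm_num) (by norm_num))).congr_deriv (by ring)
    · refine (((d 4 0 x (by norm_num) (by norm_num)).add
        ((d 3 1 x (by norm_num) (by norm_num)).const_mul 2)).add
        (d 2 2 x (by norm_num) (by norm_num))).congr_deriv (by ring)
  have bsq : ∀ x, |sq 5 x| ≤ 32 * (K * K) := fun x => by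
    have h1 := abs_le.1 (m 2 3 x (by norm_num) (by norm_num))
    have h2 := abs_le.1 (m 1 4 x (by norm_num) (by norm_num))
    have h3 := abs_le.1 (m 0 5 x (by norm_num) (by norm_num))
    simp only [sq]
    rw [abs_le]; constructor <;> linarith
  have bpr : ∀ x, |pr 3 x| ≤ 8 * (K * K) := fun x => by
    have h1 := abs_le.1 (m 5 0 x (by norm_num) (by norm_num))
    have h2 := abs_le.1 (m 4 1 x (by norm_num) (by norm_num))
    have h3 := abs_le.1 (m 3 2 x (by norm_num) (by norm_num))
    simp only [pr]
    rw [abs_le]; constructor <;> linarith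
  have e1 := dxCentral_gridRestrict_fourth_order (a := a) hh hsq bsq p
  have e2 := dxCentral_gridRestrict_second_order (a := a) hh hpr bpr p
  have e3 := dxCentral_gridRestrict_fourth_order (a := a) hh (hv.mono (by norm_num))
    (hK 5 (by norm_num)) p
  have e4 := dxCentral_gridRestrict_second_order (a := a) hh
    ((hv.mono (show 5 ≤ 6 by norm_num)).shift (n := 3) (m := 2)) (hK 5 (by norm_num)) p
  have e5 := dxCentral_gridRestrict_second_order (a := a) hh (hv.mono (by norm_num))
    (hK 3 (by norm_num)) p
  simp only [zero_add, Nat.reduceAdd] at e4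
  have f1 : (fun k => gridRestrict a h (v 0) k * gridRestrict a h (v 0) k)
    = gridRestrict a h (sq 0) := rfl
  have f2 : (fun k => gridRestrict a h (v 2) k * gridRestrict a h (v 0) k)
    = gridRestrict a h (pr 0) := rfl
  simp only [Psi, f1, f2]
  simp only [sq, pr] at e1 e2 ⊢
  set x := a + p * h with hx
  have g0 : gridRestrict a h (v 0) p = v 0 x := rfl
  have g2 : gridRestrict a h (v 2) p = v 2 x := rfl
  rw [g0, g2]
  have e3' : |v 0 x * (dxCentral h (gridRestrict a h (v 0)) p - v 1 x - h ^ 2 / 6 * v 3 x)|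
      ≤ K * (K * h ^ 4) := by
    rw [abs_mul]; exact mul_le_mul (hK 0 (by norm_num) x) e3 (abs_nonneg _) hK0
  have e5' : |v 2 x * (dxCentral h (gridRestrict a h (v 0)) p - v 1 x)| ≤ K * (K * h ^ 2) := by
    rw [abs_mul]; exact mul_le_mul (hK 2 (by norm_num) x) e5 (abs_nonneg _) hK0
  rw [abs_le] at e1 e2 e3 e4 e3' e5'
  have s2 := mul_le_mul_of_nonneg_left e2.1 (sq_nonneg h)
  have s2' := mul_le_mul_of_nonneg_left e2.2 (sq_nonneg h)
  have s4 := mul_le_mul_of_nonneg_left e4.1 (sq_nonneg h)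
  have s4' := mul_le_mul_of_nonneg_left e4.2 (sq_nonneg h)
  have s5 := mul_le_mul_of_nonneg_left e5'.1 (sq_nonneg h)
  have s5' := mul_le_mul_of_nonneg_left e5'.2 (sq_nonneg h)
  have n1 : 0 ≤ K ^ 2 * h ^ 4 := by positivity
  have n2 : 0 ≤ K * h ^ 4 := by positivity
  have := e1.1
  have := e1.2
  have := e3.1
  have := e3.2
  have := e3'.1
  have := e3'.2
  clear e1 e2 e3 e4 e3' e5' e5
  rw [abs_le]
  constructor <;> linarith

end BBMB

/-! ### Regularity data of the exact solution: periodicity, uniform bounds, the equation up to `t =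
0`. -/

namespace BBMB

/-- The derivatives `D i j = ∂ₓⁱ ∂ₜʲ u` (`i ≤ 6`, `j ≤ 1`) and `E i j = ∂ₓⁱ ∂ₜʲ u` (`i ≤ 2`, `j ≤ 3`)
of a solution, all of them bounded by `K`. -/
structure ExactData (μ lam L T K : ℝ) (u : ℝ → ℝ → ℝ) (D E : ℕ → ℕ → ℝ → ℝ → ℝ) : Prop where
  eq_u : ∀ x, ∀ t ∈ Icc 0 T, D 0 0 x t = u x t
  bound : ∀ i ≤ 6, ∀ j ≤ 1, ∀ x, ∀ t ∈ Icc 0 T, |D i j x t| ≤ K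
  bound_time : ∀ i ≤ 2, ∀ j ≤ 3, ∀ x, ∀ t ∈ Icc 0 T, |E i j x t| ≤ K
  deriv_space : ∀ i < 6, ∀ x, ∀ t ∈ Icc 0 T,
    HasDerivAt (fun y => D i 0 y t) (D (i + 1) 0 x t) x
  deriv_once : ∀ i ≤ 6, ∀ x, ∀ t ∈ Icc 0 T,
    HasDerivWithinAt (fun s => D i 0 x s) (D i 1 x t) (Icc 0 T) t
  deriv_time : ∀ i ≤ 2, ∀ j < 3, ∀ x, ∀ t ∈ Icc 0 T,
    HasDerivWithinAt (fun s => E i j x s) (E i (j + 1) x t) (Icc 0 T) t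
  eq_zero : ∀ i ≤ 2, ∀ x, ∀ t ∈ Icc 0 T, E i 0 x t = D i 0 x t
  eq_one : ∀ i ≤ 2, ∀ x, ∀ t ∈ Icc 0 T, E i 1 x t = D i 1 x t
  equation : ∀ x, ∀ t ∈ Icc 0 T,
    D 0 1 x t - μ * D 2 1 x t + D 0 0 x t * D 1 0 x t + D 1 0 x t - lam * D 2 0 x t = 0
  periodic : ∀ i ≤ 6, ∀ x, ∀ t ∈ Icc 0 T, D i 0 (x + L) t = D i 0 x t

/-- The equation and the periodicity are given for `t > 0` only, while the first time step uses them
at `t = 0`. -/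
theorem eqOn_Icc_of_eqOn_Ioc {T : ℝ} (hT : 0 < T) {f g : ℝ → ℝ} (hf : ContinuousOn f (Icc 0 T))
    (hg : ContinuousOn g (Icc 0 T)) (h : ∀ t ∈ Ioc 0 T, f t = g t) : ∀ t ∈ Icc 0 T, f t = g t :=
  Set.EqOn.of_subset_closure (s := Ioc 0 T) h hf hg Ioc_subset_Icc_self
    (by rw [closure_Ioc hT.ne])

theorem continuousOn_slice {T : ℝ} {F : ℝ → ℝ → ℝ}
    (hF : ContinuousOn (fun z : ℝ × ℝ => F z.1 z.2) (univ ×ˢ Icc 0 T)) (x : ℝ) :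
    ContinuousOn (F x) (Icc 0 T) :=
  hF.comp (f := fun t : ℝ => (x, t)) (by fun_prop) (fun t ht => ⟨mem_univ _, ht⟩)

theorem periodic_of_mixed {m n : ℕ} {L T : ℝ} (hT : 0 < T) {D : ℕ → ℕ → ℝ → ℝ → ℝ}
    (h0 : ∀ x, ∀ t ∈ Icc 0 T, D 0 0 (x + L) t = D 0 0 x t)
    (hD : ∀ i ≤ m, ∀ j ≤ n,
      ContinuousOn (fun z : ℝ × ℝ => D i j z.1 z.2) (univ ×ˢ Icc 0 T) ∧
      (i < m → ∀ x, ∀ t ∈ Icc 0 T, HasDerivAt (fun y => D i j y t) (D (i + 1) j x t) x) ∧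
      (j < n → ∀ x, ∀ t ∈ Icc 0 T,
        HasDerivWithinAt (fun s => D i j x s) (D i (j + 1) x t) (Icc 0 T) t)) :
    ∀ i ≤ m, ∀ j ≤ n, ∀ x, ∀ t ∈ Icc 0 T, D i j (x + L) t = D i j x t := by
  intro i
  induction i with
  | zero =>
    intro _ j
    induction j with
    | zero => intro _; exact h0
    | succ j ih =>
      intro hj x t ht
      have h1 := (hD 0 (by omega) j (by omega)).2.2 (by omega) x t ht
      have h2 := (hD 0 (by omega) j (by omega)).2.2 (by omega) (x + L) t ht
      have h3 := h2.congr (f₁ := fun s => D 0 j x s) (fun s hs => (ih (by omega) x s hs).symm)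
        (ih (by omega) x t ht).symm
      exact (uniqueDiffOn_Icc hT t ht).eq_deriv _ h3 h1
  | succ i ih =>
    intro hi j hj x t ht
    have h1 := (hD i (by omega) j hj).2.1 (by omega) x t ht
    have h2 := ((hD i (by omega) j hj).2.1 (by omega) (x + L) t ht).comp_add_const x L
    have h3 : (fun y => D i j (y + L) t) = fun y => D i j y t :=
      funext fun y => ih (by omega) j hj y t ht
    rw [h3] at h2
    exact h2.unique h1

theorem bounded_of_periodic {L T : ℝ} (hL : 0 < L) {F : ℝ → ℝ → ℝ}
    (hF : ContinuousOn (fun z : ℝ × ℝ => F z.1 z.2) (univ ×ˢ Icc 0 T))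
    (hper : ∀ x, ∀ t ∈ Icc 0 T, F (x + L) t = F x t) :
    ∃ K : ℝ, ∀ x, ∀ t ∈ Icc 0 T, |F x t| ≤ K := by
  obtain ⟨K, hK⟩ := (isCompact_Icc (a := (0 : ℝ)) (b := L)).prod (isCompact_Icc (a := (0 : ℝ))
    (b := T)) |>.exists_bound_of_continuousOn (hF.mono (prod_mono (subset_univ _) Subset.rfl))
  refine ⟨K, fun x t ht => ?_⟩
  have hp : Function.Periodic (fun y => F y t) L := fun y => hper y t ht
  obtain ⟨y, hy, hxy⟩ := hp.exists_mem_Ico₀ hL x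
  rw [hxy]
  exact hK (y, t) ⟨Ico_subset_Icc_self hy, ht⟩

theorem exists_uniform_bound {m n : ℕ} {T : ℝ} {D : ℕ → ℕ → ℝ → ℝ → ℝ}
    (hD : ∀ i ≤ m, ∀ j ≤ n, ∃ K : ℝ, ∀ x, ∀ t ∈ Icc 0 T, |D i j x t| ≤ K) :
    ∃ K : ℝ, ∀ i ≤ m, ∀ j ≤ n, ∀ x, ∀ t ∈ Icc 0 T, |D i j x t| ≤ K := by
  choose! B hB using hD
  obtain ⟨K, hK⟩ := ((Finset.range (m + 1) ×ˢ Finset.range (n + 1)).image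
    fun z => B z.1 z.2).exists_le
  refine ⟨K, fun i hi j hj x t ht => (hB i hi j hj x t ht).trans (hK _ ?_)⟩
  refine Finset.mem_image.2 ⟨(i, j), ?_, rfl⟩
  simp only [Finset.mem_product, Finset.mem_range]
  omega

theorem IsExactSolution.exists_data {μ lam L T : ℝ} {φ : ℝ → ℝ} {u w : ℝ → ℝ → ℝ} (hL : 0 < L)
    (hT : 0 < T) (hu : IsExactSolution μ lam L T φ u w) :
    ∃ K : ℝ, ∃ D E : ℕ → ℕ → ℝ → ℝ → ℝ, 0 < K ∧ ExactData μ lam L T K u D E := by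
  obtain ⟨D, hD0, hD⟩ := hu.smooth_space
  obtain ⟨E, hE0, hE⟩ := hu.smooth_time
  have hper : ∀ x, ∀ t ∈ Icc 0 T, D 0 0 (x + L) t = D 0 0 x t := by
    intro x
    have hc := (hD 0 (by norm_num) 0 (by norm_num)).1
    refine eqOn_Icc_of_eqOn_Ioc hT (continuousOn_slice hc _) (continuousOn_slice hc _) ?_
    intro t ht
    rw [hD0 _ t (Ioc_subset_Icc_self ht), hD0 _ t (Ioc_subset_Icc_self ht)]
    exact (hu.periodic x t ht).symm
  have hED : ∀ x, ∀ t ∈ Icc 0 T, E 0 0 x t = D 0 0 x t := fun x t ht => by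
    rw [hD0 x t ht, hE0 x t ht]
  have hperE : ∀ x, ∀ t ∈ Icc 0 T, E 0 0 (x + L) t = E 0 0 x t := fun x t ht => by
    rw [hED _ t ht, hED _ t ht, hper x t ht]
  have pD := periodic_of_mixed hT hper hD
  have pE := periodic_of_mixed hT hperE hE
  obtain ⟨K₁, hK₁⟩ := exists_uniform_bound fun i hi j hj =>
    bounded_of_periodic hL (hD i hi j hj).1 (pD i hi j hj)
  obtain ⟨K₂, hK₂⟩ := exists_uniform_bound fun i hi j hj =>
    bounded_of_periodic hL (hE i hi j hj).1 (pE i hi j hj)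
  -- The two smoothness classes come with separate families of derivatives; uniqueness of
  -- derivatives identifies them where both are used.
  have hz : ∀ i ≤ 2, ∀ x, ∀ t ∈ Icc 0 T, E i 0 x t = D i 0 x t := by
    intro i
    induction i with
    | zero => intro _; exact hED
    | succ i ih =>
      intro hi x t ht
      have h1 := (hD i (by omega) 0 (by omega)).2.1 (by omega) x t ht
      have h2 := (hE i (by omega) 0 (by omega)).2.1 (by omega) x t ht
      have h3 : (fun y => E i 0 y t) = fun y => D i 0 y t :=
        funext fun y => ih (by omega) y t ht
      rw [h3] at h2
      exact h2.unique h1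
  have ho : ∀ i ≤ 2, ∀ x, ∀ t ∈ Icc 0 T, E i 1 x t = D i 1 x t := by
    intro i hi x t ht
    have h1 := (hD i (by omega) 0 (by omega)).2.2 (by omega) x t ht
    have h2 := (hE i (by omega) 0 (by omega)).2.2 (by omega) x t ht
    have h3 := h1.congr (f₁ := fun s => E i 0 x s) (fun s hs => hz i hi x s hs) (hz i hi x t ht)
    exact (uniqueDiffOn_Icc hT t ht).eq_deriv _ h2 h3
  have hx1 : ∀ x, ∀ t ∈ Icc 0 T, deriv (fun y => u y t) x = D 1 0 x t := by
    intro x t ht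
    have h1 := (hD 0 (by omega) 0 (by omega)).2.1 (by omega) x t ht
    have h3 : (fun y => D 0 0 y t) = fun y => u y t := funext fun y => hD0 y t ht
    rw [h3] at h1
    exact h1.deriv
  have hw : ∀ x, ∀ t ∈ Ioc 0 T, w x t = D 2 0 x t := by
    intro x t ht
    have ht' := Ioc_subset_Icc_self ht
    rw [hu.aux x t ht, iteratedDeriv_succ, iteratedDeriv_one]
    have : deriv (fun y => u y t) = fun y => D 1 0 y t := funext fun y => hx1 y t ht'
    rw [this]
    exact ((hD 1 (by omega) 0 (by omega)).2.1 (by omega) x t ht').deriv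
  refine ⟨|K₁| + |K₂| + 1, D, E, by positivity, hD0, ?_, ?_, ?_, ?_, ?_, hz, ho, ?_, ?_⟩
  · intro i hi j hj x t ht
    have := hK₁ i hi j hj x t ht
    linarith [le_abs_self K₁, abs_nonneg K₂]
  · intro i hi j hj x t ht
    have := hK₂ i hi j hj x t ht
    linarith [le_abs_self K₂, abs_nonneg K₁]
  · exact fun i hi x t ht => (hD i (by omega) 0 (by omega)).2.1 hi x t ht
  · exact fun i hi x t ht => (hD i hi 0 (by omega)).2.2 (by omega) x t ht
  · exact fun i hi j hj x t ht => (hE i hi j (by omega)).2.2 hj x t ht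
  · intro x
    have c := fun i (hi : i ≤ 6) j (hj : j ≤ 1) => continuousOn_slice (hD i hi j hj).1 x
    refine eqOn_Icc_of_eqOn_Ioc (g := fun _ => 0) hT ?_ continuousOn_const ?_
    · have c01 := c 0 (by omega) 1 (by omega)
      have c21 := c 2 (by omega) 1 (by omega)
      have c00 := c 0 (by omega) 0 (by omega)
      have c10 := c 1 (by omega) 0 (by omega)
      have c20 := c 2 (by omega) 0 (by omega)
      exact (((c01.sub (continuousOn_const.mul c21)).add (c00.mul c10)).add c10).sub
        (continuousOn_const.mul c20)
    · intro t ht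
      have ht' := Ioc_subset_Icc_self ht
      have hud := uniqueDiffOn_Icc hT t ht'
      have d1 : derivWithin (fun s => u x s) (Icc 0 T) t = D 0 1 x t := by
        have := (hD 0 (by omega) 0 (by omega)).2.2 (by omega) x t ht'
        exact (this.congr (fun s hs => (hD0 x s hs).symm) (hD0 x t ht').symm).derivWithin hud
      have d2 : derivWithin (fun s => w x s) (Icc 0 T) t = D 2 1 x t := by
        have := (hD 2 (by omega) 0 (by omega)).2.2 (by omega) x t ht'
        -- `w` is known to be `u_xx` only for positive times, so equality is available near `t > 0`,
        -- not on the whole interval.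
        refine (this.congr_of_eventuallyEq ?_ (hw x t ht)).derivWithin hud
        filter_upwards [self_mem_nhdsWithin,
          mem_nhdsWithin_of_mem_nhds (Ioi_mem_nhds ht.1)] with s hs hs'
        exact hw x s ⟨hs', hs.2⟩
      have := hu.equation x t ht
      rwa [d1, d2, hx1 x t ht', hw x t ht, ← hD0 x t ht'] at this
  · exact fun i hi x t ht => pD i hi 0 (by omega) x t ht

end BBMB

/-! ### Consistency of the scheme. -/

namespace BBMB

/-- The left hand side of the compact Crank-Nicolson scheme, in terms of the values of the two
grid functions at the new and at the old time level. -/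
noncomputable def schemeResidual (μ lam h τ : ℝ) (U1 U0 V1 V0 : ℤ → ℝ) (p : ℤ) : ℝ :=
  (U1 p - U0 p) / τ - μ * ((V1 p - V0 p) / τ) + Psi h (gridMean U1 U0) (gridMean U1 U0) p
    - h ^ 2 / 2 * Psi h (gridMean V1 V0) (gridMean U1 U0) p
    + dxCentral h (gridMean U1 U0) p - h ^ 2 / 6 * dxCentral h (gridMean V1 V0) p
    - lam * gridMean V1 V0 p

/-- By bilinearity, `Psi` of two means is the mean of the `Psi` values minus a quarter of `Psi` of
the two time differences. Each time difference is of order `τ`, so this correction is of order `τ²`.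
Averaging the equation at the two times removes the leading terms. -/
theorem schemeResidual_eq (μ lam h τ : ℝ) (U1 U0 W1 W0 s1 s0 : ℤ → ℝ) (p : ℤ)
    (a1 a0 b1 b0 c1 c0 : ℝ)
    (h1 : a1 - μ * b1 + c1 - lam * W1 p = 0) (h0 : a0 - μ * b0 + c0 - lam * W0 p = 0) :
    schemeResidual μ lam h τ U1 U0 (fun p => W1 p + s1 p) (fun p => W0 p + s0 p) p =
      ((U1 p - U0 p) / τ - (a1 + a0) / 2) - μ * ((W1 p - W0 p) / τ - (b1 + b0) / 2)
      - μ * ((s1 p - s0 p) / τ)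
      + (Psi h U1 U1 p - h ^ 2 / 2 * Psi h W1 U1 p + dxCentral h U1 p
          - h ^ 2 / 6 * dxCentral h W1 p - c1) / 2
      + (Psi h U0 U0 p - h ^ 2 / 2 * Psi h W0 U0 p + dxCentral h U0 p
          - h ^ 2 / 6 * dxCentral h W0 p - c0) / 2
      - 1 / 4 * Psi h (fun p => U1 p - U0 p) (fun p => U1 p - U0 p) p
      + 1 / 4 * (h ^ 2 / 2 * Psi h (fun p => W1 p - W0 p) (fun p => U1 p - U0 p) p)
      - h ^ 2 / 2 * Psi h (gridMean s1 s0) (gridMean U1 U0) p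
      - h ^ 2 / 6 * dxCentral h (gridMean s1 s0) p - lam * gridMean s1 s0 p := by
  simp only [schemeResidual, Psi, dxCentral, gridMean]
  linear_combination h1 / 2 + h0 / 2

theorem dxCentral_gridMean (h : ℝ) (v w : ℤ → ℝ) (p : ℤ) :
    dxCentral h (gridMean v w) p = (dxCentral h v p + dxCentral h w p) / 2 := by
  simp only [dxCentral, gridMean]; ring

theorem abs_mean_le {x y K : ℝ} (hx : |x| ≤ K) (hy : |y| ≤ K) : |(x + y) / 2| ≤ K := by
  rw [abs_le] at *; constructor <;> linarith

theorem abs_dxCentral_le {h σ : ℝ} (hh : 0 < h) {v : ℤ → ℝ} (hv : ∀ p, |v p| ≤ σ) (p : ℤ) :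
    |dxCentral h v p| ≤ σ / h := by
  have h1 := abs_le.1 (hv (p + 1))
  have h2 := abs_le.1 (hv (p - 1))
  rw [dxCentral, abs_div, abs_of_pos (show 0 < 2 * h by positivity),
    div_le_div_iff₀ (by positivity) hh, show σ * (2 * h) = (2 * σ) * h by ring]
  refine mul_le_mul_of_nonneg_right ?_ hh.le
  rw [abs_le]; constructor <;> linarith

namespace ExactData

variable {μ lam L T K a h τ t : ℝ} {u : ℝ → ℝ → ℝ} {D E : ℕ → ℕ → ℝ → ℝ → ℝ}

theorem chain (H : ExactData μ lam L T K u D E) (ht : t ∈ Icc 0 T) :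
    IsDerivChain 6 (fun k x => D k 0 x t) := fun k hk x => H.deriv_space k hk x t ht

theorem chain_diff (H : ExactData μ lam L T K u D E) (ht : t ∈ Icc 0 T) (ht' : t + τ ∈ Icc 0 T) :
    IsDerivChain 6 (fun k x => D k 0 x (t + τ) - D k 0 x t) := fun k hk x =>
  (H.deriv_space k hk x _ ht').sub (H.deriv_space k hk x t ht)

theorem abs_diff_le (H : ExactData μ lam L T K u D E) (hτ : 0 < τ) (ht : t ∈ Icc 0 T)
    (ht' : t + τ ∈ Icc 0 T) {i : ℕ} (hi : i ≤ 6) (x : ℝ) :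
    |D i 0 x (t + τ) - D i 0 x t| ≤ K * τ := by
  have := (convex_Icc 0 T).norm_image_sub_le_of_norm_hasDerivWithin_le
    (fun s hs => H.deriv_once i hi x s hs) (fun s hs => H.bound i hi 1 le_rfl x s hs) ht ht'
  simpa [abs_of_pos hτ] using this

theorem trapezoid (H : ExactData μ lam L T K u D E) (hτ : 0 < τ) (ht : t ∈ Icc 0 T)
    (ht' : t + τ ∈ Icc 0 T) {i : ℕ} (hi : i ≤ 2) (x : ℝ) :
    |(D i 0 x (t + τ) - D i 0 x t) / τ - (D i 1 x (t + τ) + D i 1 x t) / 2| ≤ 2 * K * τ ^ 2 := by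
  have := trapezoid_le (v := fun k s => E i k x s) hτ ht ht'
    (fun k hk s hs => H.deriv_time i hi k hk x s hs)
    (fun s hs => H.bound_time i hi 3 le_rfl x s hs)
  simp only [H.eq_zero i hi x _ ht, H.eq_zero i hi x _ ht', H.eq_one i hi x _ ht,
    H.eq_one i hi x _ ht'] at this
  exact this

theorem abs_gridMean_le (H : ExactData μ lam L T K u D E) (ht : t ∈ Icc 0 T)
    (ht' : t + τ ∈ Icc 0 T) (p : ℤ) :
    |gridMean (gridRestrict a h fun x => D 0 0 x (t + τ))
      (gridRestrict a h fun x => D 0 0 x t) p| ≤ K :=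
  abs_mean_le (H.bound 0 (by norm_num) 0 (by norm_num) _ _ ht')
    (H.bound 0 (by norm_num) 0 (by norm_num) _ _ ht)

theorem abs_dxCentral_gridMean_le (H : ExactData μ lam L T K u D E) (hh : 0 < h)
    (ht : t ∈ Icc 0 T) (ht' : t + τ ∈ Icc 0 T) (p : ℤ) :
    |dxCentral h (gridMean (gridRestrict a h fun x => D 0 0 x (t + τ))
      (gridRestrict a h fun x => D 0 0 x t)) p| ≤ K := by
  rw [dxCentral_gridMean]
  exact abs_mean_le
    (dxCentral_gridRestrict_le (a := a) hh ((H.chain ht').mono (by norm_num))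
      (fun x => H.bound 1 (by norm_num) 0 (by norm_num) x _ ht') p)
    (dxCentral_gridRestrict_le (a := a) hh ((H.chain ht).mono (by norm_num))
      (fun x => H.bound 1 (by norm_num) 0 (by norm_num) x _ ht) p)

/-- The constant in the consistency estimate. -/
noncomputable def consistencyConst (μ lam L K : ℝ) : ℝ :=
  2 * K + 2 * K * μ + K ^ 2 * (1 + L ^ 2) + (13 * K ^ 2 + 2 * K)
    + 5 * K * (μ + K * (L ^ 2 + L) + L + lam)

theorem consistency (H : ExactData μ lam L T K u D E) (hμ : 0 < μ) (hlam : 0 < lam) (hK : 0 < K)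
    (hh : 0 < h) (hhL : h ≤ L) (hτ : 0 < τ) (ht : t ∈ Icc 0 T) (ht' : t + τ ∈ Icc 0 T)
    {s1 s0 : ℤ → ℝ} (hs1 : ∀ p, |s1 p| ≤ 5 * K * h ^ 4) (hs0 : ∀ p, |s0 p| ≤ 5 * K * h ^ 4)
    (hds : ∀ p, |s1 p - s0 p| ≤ 5 * K * h ^ 4 * τ) (p : ℤ) :
    |schemeResidual μ lam h τ (gridRestrict a h fun x => D 0 0 x (t + τ))
      (gridRestrict a h fun x => D 0 0 x t)
      (fun p => gridRestrict a h (fun x => D 2 0 x (t + τ)) p + s1 p)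
      (fun p => gridRestrict a h (fun x => D 2 0 x t) p + s0 p) p|
      ≤ consistencyConst μ lam L K * (τ ^ 2 + h ^ 4) := by
  have E1 := H.equation (a + p * h) (t + τ) ht'
  have E0 := H.equation (a + p * h) t ht
  rw [schemeResidual_eq μ lam h τ _ _ _ _ s1 s0 p
    (D 0 1 (a + p * h) (t + τ)) (D 0 1 (a + p * h) t) (D 2 1 (a + p * h) (t + τ))
    (D 2 1 (a + p * h) t)
    (D 0 0 (a + p * h) (t + τ) * D 1 0 (a + p * h) (t + τ) + D 1 0 (a + p * h) (t + τ))
    (D 0 0 (a + p * h) t * D 1 0 (a + p * h) t + D 1 0 (a + p * h) t)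
    (by rw [gridRestrict]; linear_combination E1) (by rw [gridRestrict]; linear_combination E0)]
  have T0 := abs_le.1 (H.trapezoid hτ ht ht' (i := 0) (by norm_num) (a + p * h))
  have T2 := abs_le.1 (H.trapezoid hτ ht ht' (i := 2) (by norm_num) (a + p * h))
  have S1 := abs_le.1 (spatial_consistency (a := a) hh (H.chain ht')
    (fun k hk x => H.bound k hk 0 (by norm_num) x _ ht') p)
  have S0 := abs_le.1 (spatial_consistency (a := a) hh (H.chain ht)
    (fun k hk x => H.bound k hk 0 (by norm_num) x _ ht) p)
  have dsτ : |(s1 p - s0 p) / τ| ≤ 5 * K * h ^ 4 := by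
    rw [abs_div, abs_of_pos hτ, div_le_iff₀ hτ]; exact hds p
  have dU : ∀ i ≤ 5, ∀ p, |dxCentral h (fun p => gridRestrict a h (fun x => D i 0 x (t + τ)) p
      - gridRestrict a h (fun x => D i 0 x t) p) p| ≤ K * τ := fun i hi p =>
    dxCentral_gridRestrict_le (a := a) hh
      (v := fun k x => D (i + k) 0 x (t + τ) - D (i + k) 0 x t)
      (fun k hk x => H.chain_diff ht ht' (i + k) (by omega) x)
      (fun x => H.abs_diff_le hτ ht ht' (by omega) x) p
  have dUn : ∀ i ≤ 5, ∀ p, |gridRestrict a h (fun x => D i 0 x (t + τ)) p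
      - gridRestrict a h (fun x => D i 0 x t) p| ≤ K * τ := fun i hi p =>
    H.abs_diff_le hτ ht ht' (by omega) _
  have Q1 := abs_le.1 (abs_Psi_le (dUn 0 (by norm_num)) (dU 0 (by norm_num))
    (dUn 0 (by norm_num)) (dU 0 (by norm_num)) p)
  have Q2 := abs_Psi_le (dUn 2 (by norm_num)) (dU 2 (by norm_num))
    (dUn 0 (by norm_num)) (dU 0 (by norm_num)) p
  have Um := H.abs_gridMean_le (a := a) (h := h) ht ht'
  have dUm := H.abs_dxCentral_gridMean_le (a := a) hh ht ht'
  have sm : ∀ p, |gridMean s1 s0 p| ≤ 5 * K * h ^ 4 := fun p => abs_mean_le (hs1 p) (hs0 p)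
  have dsm := abs_dxCentral_le hh sm
  set σ := 5 * K * h ^ 4 with hσ
  have hσ0 : 0 ≤ σ := by positivity
  have hσh : 0 ≤ σ / h := by positivity
  -- The defect has no known smoothness on the grid, so its difference quotient costs a factor `1 /
  -- h`. The `h²` in front of these terms makes up for it.
  have Q3 := abs_Psi_le (A := σ + σ / h) (fun p => (sm p).trans (by linarith))
    (fun p => (dsm p).trans (by linarith)) Um dUm p
  have hL : 0 < L := hh.trans_le hhL
  have h2L : h ^ 2 ≤ L ^ 2 := pow_le_pow_left₀ hh.le hhL 2
  have Q2' : |h ^ 2 / 2 * Psi h (fun p => gridRestrict a h (fun x => D 2 0 x (t + τ)) p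
      - gridRestrict a h (fun x => D 2 0 x t) p)
      (fun p => gridRestrict a h (fun x => D 0 0 x (t + τ)) p
      - gridRestrict a h (fun x => D 0 0 x t) p) p| ≤ L ^ 2 / 2 * (K * τ * (K * τ)) := by
    rw [abs_mul, abs_of_pos (show 0 < h ^ 2 / 2 by positivity)]
    exact mul_le_mul (by linarith) Q2 (abs_nonneg _) (by positivity)
  have Q3' : |h ^ 2 / 2 * Psi h (gridMean s1 s0)
      (gridMean (gridRestrict a h fun x => D 0 0 x (t + τ)) (gridRestrict a h fun x => D 0 0 x t)) p|
      ≤ σ * K * (L ^ 2 + L) := by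
    rw [abs_mul, abs_of_pos (show 0 < h ^ 2 / 2 by positivity)]
    refine (mul_le_mul_of_nonneg_left Q3 (by positivity)).trans ?_
    have e : h ^ 2 / 2 * ((σ + σ / h) * K) = σ * K * ((h ^ 2 + h) / 2) := by field_simp
    rw [e]
    refine mul_le_mul_of_nonneg_left ?_ (by positivity)
    linarith [sq_nonneg L]
  have Q4 : |h ^ 2 / 6 * dxCentral h (gridMean s1 s0) p| ≤ σ * L := by
    rw [abs_mul, abs_of_pos (show 0 < h ^ 2 / 6 by positivity)]
    refine (mul_le_mul_of_nonneg_left (dsm p) (by positivity)).trans ?_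
    have e : h ^ 2 / 6 * (σ / h) = σ * (h / 6) := by field_simp
    rw [e]
    exact mul_le_mul_of_nonneg_left (by linarith) hσ0
  have Q5 : |lam * gridMean s1 s0 p| ≤ lam * σ := by
    rw [abs_mul, abs_of_pos hlam]
    exact mul_le_mul_of_nonneg_left (sm p) hlam.le
  have Q6 : |μ * ((s1 p - s0 p) / τ)| ≤ μ * σ := by
    rw [abs_mul, abs_of_pos hμ]
    exact mul_le_mul_of_nonneg_left dsτ hμ.le
  have T2' : |μ * ((D 2 0 (a + p * h) (t + τ) - D 2 0 (a + p * h) t) / τ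
      - (D 2 1 (a + p * h) (t + τ) + D 2 1 (a + p * h) t) / 2)| ≤ μ * (2 * K * τ ^ 2) := by
    rw [abs_mul, abs_of_pos hμ]
    exact mul_le_mul_of_nonneg_left (abs_le.2 T2) hμ.le
  rw [abs_le] at Q2' Q3' Q4 Q5 Q6 T2'
  have hτ2 : 0 ≤ τ ^ 2 := sq_nonneg τ
  have hh4 : 0 ≤ h ^ 4 := by positivity
  have n1 : 0 ≤ K ^ 2 * τ ^ 2 := by positivity
  have n2 : 0 ≤ K ^ 2 * L ^ 2 * τ ^ 2 := by positivity
  have hC : 2 * K * τ ^ 2 + μ * (2 * K * τ ^ 2) + μ * σ + (13 * K ^ 2 + 2 * K) * h ^ 4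
      + 1 / 4 * (K * τ * (K * τ)) + 1 / 4 * (L ^ 2 / 2 * (K * τ * (K * τ))) + σ * K * (L ^ 2 + L)
      + σ * L + lam * σ ≤ consistencyConst μ lam L K * (τ ^ 2 + h ^ 4) := by
    have m1 : 0 ≤ 2 * K * h ^ 4 := by positivity
    have m2 : 0 ≤ 2 * K * μ * h ^ 4 := by positivity
    have m3 : 0 ≤ K ^ 2 * (1 + L ^ 2) * h ^ 4 := by positivity
    have m4 : 0 ≤ (13 * K ^ 2 + 2 * K) * τ ^ 2 := by positivity
    have m5 : 0 ≤ 5 * K * (μ + K * (L ^ 2 + L) + L + lam) * τ ^ 2 := by positivity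
    rw [hσ, consistencyConst]
    linarith
  refine le_trans ?_ hC
  clear hC dU dUn Um dUm sm dsm Q3 dsτ Q2 E1 E0 T2
  simp only [gridRestrict] at *
  rw [abs_le]
  constructor
  · linarith [T0.1, T2'.2, Q6.2, S1.1, S0.1, Q1.2, Q2'.1, Q3'.2, Q4.2, Q5.2]
  · linarith [T0.2, T2'.1, Q6.1, S1.2, S0.2, Q1.1, Q2'.2, Q3'.1, Q4.1, Q5.1]

end ExactData

end BBMB

/-! ### The discrete Sobolev inequality and the global energy bound. -/

namespace BBMB

theorem abs_sub_le_sum_Ioc (w : ℤ → ℝ) {r p : ℤ} (hrp : r ≤ p) :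
    |w p - w r| ≤ ∑ j ∈ Finset.Ioc r p, |w j - w (j - 1)| := by
  induction p, hrp using Int.leInduction with
  | base => simp
  | succ p hp ih =>
    have : Finset.Ioc r (p + 1) = insert (p + 1) (Finset.Ioc r p) := by
      ext j; simp only [Finset.mem_Ioc, Finset.mem_insert]; omega
    rw [this, Finset.sum_insert (by simp), add_sub_cancel_right]
    calc |w (p + 1) - w r| = |(w (p + 1) - w p) + (w p - w r)| := by ring_nf
      _ ≤ _ := (abs_add_le _ _).trans (by linarith)

theorem abs_sub_le_sum (w : ℤ → ℝ) {M : ℕ} {r p : ℤ} (hr : r ∈ Finset.Icc (1 : ℤ) M)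
    (hp : p ∈ Finset.Icc (1 : ℤ) M) :
    |w p - w r| ≤ ∑ j ∈ Finset.Icc (1 : ℤ) M, |w j - w (j - 1)| := by
  rw [Finset.mem_Icc] at hr hp
  have sub : ∀ {r p : ℤ}, 1 ≤ r → p ≤ M → Finset.Ioc r p ⊆ Finset.Icc (1 : ℤ) M :=
    fun h1 h2 j hj => by rw [Finset.mem_Ioc] at hj; rw [Finset.mem_Icc]; omega
  rcases le_total r p with h | h
  · exact (abs_sub_le_sum_Ioc w h).trans
      (Finset.sum_le_sum_of_subset_of_nonneg (sub hr.1 hp.2) fun _ _ _ => abs_nonneg _)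
  · rw [abs_sub_comm]
    exact (abs_sub_le_sum_Ioc w h).trans
      (Finset.sum_le_sum_of_subset_of_nonneg (sub hp.1 hr.2) fun _ _ _ => abs_nonneg _)

theorem sum_abs_le {M : ℕ} {h L : ℝ} (hL : 0 < L) (hhL : M * h = L) (v : ℤ → ℝ) :
    h * ∑ p ∈ Finset.Icc (1 : ℤ) M, |v p| ≤ √L * √(gridInner M h v v) := by
  rw [← Real.sqrt_mul hL.le]
  refine Real.le_sqrt_of_sq_le ?_
  have := sq_sum_le_card_mul_sum_sq (s := Finset.Icc (1 : ℤ) M) (f := fun p => |v p|)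
  simp only [sq_abs, Int.card_Icc, add_sub_cancel_right, Int.toNat_natCast] at this
  have h2 := mul_le_mul_of_nonneg_left this (sq_nonneg h)
  have e : ∑ p ∈ Finset.Icc (1 : ℤ) M, v p * v p = ∑ p ∈ Finset.Icc (1 : ℤ) M, v p ^ 2 :=
    Finset.sum_congr rfl fun p _ => (sq (v p)).symm
  rw [gridInner, e, ← hhL]
  linarith

/-- A discrete Sobolev inequality. -/
theorem normMax_le {M : ℕ} {h L : ℝ} (hM : 1 ≤ M) (hh : 0 < h) (hL : 0 < L) (hhL : M * h = L)
    (w : ℤ → ℝ) : normMax M w ≤ normL2 M h w / √L + √L * seminormH1 M h w := by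
  have : Nonempty (Icc (1 : ℤ) M) := ⟨⟨1, by simp; omega⟩⟩
  refine ciSup_le fun ⟨p, hp⟩ => ?_
  have hp' : p ∈ Finset.Icc (1 : ℤ) M := Finset.mem_Icc.2 hp
  have s1 : ∑ j ∈ Finset.Icc (1 : ℤ) M, |w j - w (j - 1)| ≤ √L * seminormH1 M h w := by
    refine le_trans (le_of_eq ?_) (sum_abs_le hL hhL (dxHalf h w))
    rw [Finset.mul_sum]
    refine Finset.sum_congr rfl fun j _ => ?_
    rw [dxHalf, abs_div, abs_of_pos hh]; field_simp
  -- Averaging `|w p| ≤ |w r| + Σ |w j - w (j - 1)|` over `r` avoids any assumption that `w` has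
  -- mean zero or vanishes somewhere.
  have s2 : L * |w p| ≤ √L * normL2 M h w + L * (√L * seminormH1 M h w) := by
    have := Finset.sum_le_sum (s := Finset.Icc (1 : ℤ) M) (f := fun _ => |w p|)
      (g := fun r => |w r| + √L * seminormH1 M h w) (fun r hr => by
        have h1 := (abs_sub_le_sum w hr hp').trans s1
        have h2 := abs_sub_abs_le_abs_sub (w p) (w r)
        linarith)
    simp only [Finset.sum_add_distrib, Finset.sum_const, Int.card_Icc, add_sub_cancel_right,
      Int.toNat_natCast, nsmul_eq_mul] at this
    have h3 := mul_le_mul_of_nonneg_left this hh.le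
    have h4 := sum_abs_le hL hhL w
    change _ ≤ √L * normL2 M h w at h4
    have h5 : ∀ x : ℝ, h * (M * x) = L * x := fun x => by rw [← hhL]; ring
    rw [mul_add, h5, h5] at h3
    linarith
  have hs : 0 < √L := Real.sqrt_pos.2 hL
  have e : √L * normL2 M h w + L * (√L * seminormH1 M h w)
      = L * (normL2 M h w / √L + √L * seminormH1 M h w) := by
    have : L * (normL2 M h w / √L) = √L * normL2 M h w := by
      nth_rewrite 1 [← Real.mul_self_sqrt hL.le]; field_simp
    rw [mul_add, this]
  rw [e] at s2
  exact le_of_mul_le_mul_left s2 hL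

theorem gridRestrict_mem {M : ℕ} {a h L : ℝ} (hhL : M * h = L) {v : ℝ → ℝ}
    (hv : ∀ x, v (x + L) = v x) : gridRestrict a h v ∈ gridSpace M := fun p => by
  simp only [gridRestrict]
  rw [← hv (a + p * h), ← hhL]
  push_cast
  congr 1
  ring

theorem gridSpace_sub {M : ℕ} {v w : ℤ → ℝ} (hv : v ∈ gridSpace M) (hw : w ∈ gridSpace M) :
    (fun p => v p - w p) ∈ gridSpace M := fun p => by simp only [hv p, hw p]

/-- The energy of the error is of the order of the square of the consistency error. -/
theorem energy_error_le {μ lam L T K a h τ : ℝ} {M N : ℕ} {φ : ℝ → ℝ} {u : ℝ → ℝ → ℝ}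
    {D E : ℕ → ℕ → ℝ → ℝ → ℝ} {uc wc : ℕ → ℤ → ℝ}
    (H : ExactData μ lam L T K u D E) (hu0 : ∀ x, u x 0 = φ x) (hμ : 0 < μ) (hlam : 0 < lam)
    (hL : 0 < L) (hT : 0 < T) (hK : 0 < K) (hM : 1 ≤ M) (hhL : M * h = L) (hτT : N * τ = T)
    (hc : IsNumericalSolution μ lam a h τ M N φ uc wc)
    (hκ : 2 * ((K + 1) * (L ^ 2 + 2) * (1 + 18 / μ) * τ) ≤ 1) :
    ∀ q ≤ N, gridInner M h (gridError u a h τ uc q) (gridError u a h τ uc q)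
      + gridInner M h (dxHalf h (gridError u a h τ uc q)) (dxHalf h (gridError u a h τ uc q))
      ≤ (1 + 18 / μ) * (2 * L * T * ExactData.consistencyConst μ lam L K ^ 2
        * Real.exp (4 * ((K + 1) * (L ^ 2 + 2) * (1 + 18 / μ)) * T)) * (τ ^ 2 + h ^ 4) ^ 2 := by
  have hM0 : (1 : ℝ) ≤ M := by exact_mod_cast hM
  have hh : 0 < h := by
    by_contra hneg
    have := mul_nonpos_of_nonneg_of_nonpos (zero_le_one.trans hM0) (not_lt.1 hneg)
    linarith
  have hτ : 0 < τ := by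
    by_contra hneg
    have := mul_nonpos_of_nonneg_of_nonpos (Nat.cast_nonneg (α := ℝ) N) (not_lt.1 hneg)
    linarith
  have hhle : h ≤ L := by rw [← hhL]; nlinarith
  have ht : ∀ q ≤ N, (q : ℝ) * τ ∈ Icc 0 T := fun q hq => by
    refine ⟨by positivity, ?_⟩
    rw [← hτT]
    exact mul_le_mul_of_nonneg_right (by exact_mod_cast hq) hτ.le
  set U : ℕ → ℤ → ℝ := fun q => gridRestrict a h fun x => D 0 0 x (q * τ) with hU
  set W : ℕ → ℤ → ℝ := fun q => gridRestrict a h fun x => D 2 0 x (q * τ) with hW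
  have pU : ∀ q ≤ N, U q ∈ gridSpace M := fun q hq =>
    gridRestrict_mem hhL fun x => H.periodic 0 (by norm_num) x _ (ht q hq)
  have pW : ∀ q ≤ N, W q ∈ gridSpace M := fun q hq =>
    gridRestrict_mem hhL fun x => H.periodic 2 (by norm_num) x _ (ht q hq)
  have hV : ∀ q ≤ N, ∃ V ∈ gridSpace M,
      ∀ p, V p + (V (p + 1) - 2 * V p + V (p - 1)) / 12 = dxx h (U q) p := fun q hq =>
    exists_compact_inverse hM fun p => by
      simp only [dxx, dxHalf, add_sub_cancel_right, gridSpace_succ (pU q hq),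
        gridSpace_pred (pU q hq), pU q hq p]
  choose! V pV hVeq using hV
  have hdd : ∀ (g : ℤ → ℝ) p, h ^ 2 / 12 * dxx h g p = (g (p + 1) - 2 * g p + g (p - 1)) / 12 :=
    fun g p => by
      simp only [dxx, dxHalf, add_sub_cancel_right]; field_simp; ring
  set s : ℕ → ℤ → ℝ := fun q p => V q p - W q p with hs
  have ps : ∀ q ≤ N, s q ∈ gridSpace M := fun q hq => gridSpace_sub (pV q hq) (pW q hq)
  have hseq : ∀ q ≤ N, ∀ p, s q p + (s q (p + 1) - 2 * s q p + s q (p - 1)) / 12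
      = dxx h (U q) p - h ^ 2 / 12 * dxx h (W q) p - W q p := fun q hq p => by
    rw [hdd]
    simp only [hs]
    linear_combination hVeq q hq p
  have hsb : ∀ q ≤ N, ∀ p, |s q p| ≤ 5 * K * h ^ 4 := fun q hq p => by
    -- The constant is `3/2 · 3 = 9/2 ≤ 5`.
    refine (abs_le_of_compact hM (ps q hq) (hseq q hq) (fun p =>
      compact_second_difference_le (a := a) hh (H.chain (ht q hq))
        (fun x => H.bound 6 le_rfl 0 (by norm_num) x _ (ht q hq)) p) p).trans ?_
    have : 0 ≤ K * h ^ 4 := by positivity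
    linarith
  have hcast : ∀ q : ℕ, ((q + 1 : ℕ) : ℝ) * τ = q * τ + τ := fun q => by push_cast; ring
  have hds : ∀ q < N, ∀ p, |s (q + 1) p - s q p| ≤ 5 * K * h ^ 4 * τ := fun q hq p => by
    have ht0 := ht q hq.le
    have ht1 : (q : ℝ) * τ + τ ∈ Icc 0 T := hcast q ▸ ht (q + 1) hq
    -- The same estimate applied to `u(·, t + τ) - u(·, t)`, whose sixth derivative is at most `Kτ`.
    have hb := compact_second_difference_le (a := a) hh (H.chain_diff ht0 ht1)
      (fun x => H.abs_diff_le hτ ht0 ht1 le_rfl x)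
    refine (abs_le_of_compact hM (gridSpace_sub (ps (q + 1) hq) (ps q hq.le)) (fun p => ?_) hb
      p).trans ?_
    · have e1 := hseq (q + 1) hq p
      have e0 := hseq q hq.le p
      simp only [hU, hW, hcast] at e1 e0
      simp only [dxx, dxHalf, gridRestrict] at e1 e0 ⊢
      linear_combination e1 - e0
    · have : 0 ≤ K * h ^ 4 * τ := by positivity
      linarith
  set e : ℕ → ℤ → ℝ := fun q p => U q p - uc q p with he
  set f : ℕ → ℤ → ℝ := fun q p => V q p - wc q p with hf
  have pe : ∀ q ≤ N, e q ∈ gridSpace M := fun q hq => gridSpace_sub (pU q hq) (hc.periodic q hq).1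
  have pf : ∀ q ≤ N, f q ∈ gridSpace M := fun q hq => gridSpace_sub (pV q hq) (hc.periodic q hq).2
  have hlap : ∀ q ≤ N, IsCompactLaplacian M h (e q) (f q) := fun q hq p h1 h2 => by
    have a1 := hVeq q hq p
    have a2 := hc.aux q hq p h1 h2
    rw [← hdd] at a1
    simp only [dxx, dxHalf] at a1 a2 ⊢
    simp only [he, hf]
    linear_combination a1 - a2
  have hee : ∀ q ≤ N, gridError u a h τ uc q = e q := fun q hq => funext fun p => by
    simp only [gridError, he, hU, gridRestrict]
    rw [H.eq_u _ _ (ht q hq)]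
  have hstep : ∀ q < N, gridEnergy μ M h (e (q + 1)) (f (q + 1)) ≤ gridEnergy μ M h (e q) (f q)
      + τ * ((K + 1) * (L ^ 2 + 2) * (1 + 18 / μ)
        * (gridEnergy μ M h (e (q + 1)) (f (q + 1)) + gridEnergy μ M h (e q) (f q))
        + h * M * (ExactData.consistencyConst μ lam L K * (τ ^ 2 + h ^ 4)) ^ 2) := by
    intro q hq
    have ht0 := ht q hq.le
    have ht1 : (q : ℝ) * τ + τ ∈ Icc 0 T := hcast q ▸ ht (q + 1) hq
    refine energy_step (U := gridMean (U (q + 1)) (U q)) (v := gridMean (uc (q + 1)) (uc q))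
      (w := gridMean (wc (q + 1)) (wc q))
      (R := schemeResidual μ lam h τ (U (q + 1)) (U q) (V (q + 1)) (V q))
      hμ hlam hh hhle hτ (pe q hq.le) (pe (q + 1) hq) (pf q hq.le) (pf (q + 1) hq)
      (gridMean_mem (pU (q + 1) hq) (pU q hq.le))
      (gridMean_mem (hc.periodic (q + 1) hq).1 (hc.periodic q hq.le).1)
      (gridMean_mem (hc.periodic (q + 1) hq).2 (hc.periodic q hq.le).2)
      (hlap q hq.le) (hlap (q + 1) hq) ?_ ?_ ?_ ?_
    · intro p
      have := H.abs_gridMean_le (a := a) (h := h) ht0 ht1 p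
      simp only [hU, hcast]
      exact this
    · intro p
      have := H.abs_dxCentral_gridMean_le (a := a) hh ht0 ht1 p
      simp only [hU, hcast]
      exact this
    · intro p h1 h2
      have := hc.scheme (q + 1) (by omega) hq p h1 h2
      simp only [dt, Psi, midAvg, dxCentral, Nat.add_sub_cancel] at this
      simp only [schemeResidual, Psi, dxCentral, gridMean, he, hf]
      linear_combination -this
    · intro p _ _
      have := H.consistency (a := a) hμ hlam hK hh hhle hτ ht0 ht1 (hsb (q + 1) hq) (hsb q hq.le)
        (hds q hq) p
      have e1 : V (q + 1) = fun p => gridRestrict a h (fun x => D 2 0 x (q * τ + τ)) p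
          + s (q + 1) p := funext fun p => by simp only [hs, hW, hcast]; ring
      have e0 : V q = fun p => gridRestrict a h (fun x => D 2 0 x (q * τ)) p + s q p :=
        funext fun p => by simp only [hs, hW]; ring
      rw [← e1, ← e0] at this
      simp only [hU, hcast]
      exact this
  have hnorm := fun q (hq : q ≤ N) => sum_norms_le_gridEnergy hμ hh (pe q hq) (pf q hq) (hlap q hq)
  have n2 : ∀ q, 0 ≤ h ^ 2 * gridInner M h (f q) (f q) := fun q =>
    mul_nonneg (sq_nonneg h) (gridInner_self_nonneg M hh (f q))
  have hF : ∀ q ≤ N, 0 ≤ gridEnergy μ M h (e q) (f q) := fun q hq => by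
    have h1 := gridInner_self_nonneg M hh (e q)
    have h2 := gridInner_self_nonneg M hh (dxHalf h (e q))
    have h3 : 0 ≤ (1 + 18 / μ) * gridEnergy μ M h (e q) (f q) := by
      linarith [hnorm q hq, n2 q]
    exact nonneg_of_mul_nonneg_right h3 (by positivity)
  have h0 : gridEnergy μ M h (e 0) (f 0) = 0 := by
    -- Both terms of the energy contain the factor `e 0`, so `f 0` need not be computed.
    have hz : ∀ p ∈ Finset.Icc (1 : ℤ) M, e 0 p = 0 := fun p hp => by
      rw [Finset.mem_Icc] at hp
      rw [← hee 0 (Nat.zero_le N), gridError, hc.initial p hp.1 hp.2]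
      simp [hu0]
    simp only [gridEnergy, gridInner]
    rw [Finset.sum_eq_zero fun p hp => by rw [hz p hp, mul_zero],
      Finset.sum_eq_zero fun p hp => by rw [hz p hp, mul_zero]]
    ring
  have hg := discrete_gronwall (F := fun q => gridEnergy μ M h (e q) (f q)) hτ.le
    (by positivity) (by positivity) hκ h0 hF hstep
  intro q hq
  rw [hee q hq]
  have h1 := hnorm q hq
  have h2 := hg q hq
  rw [hτT, mul_comm h, hhL] at h2
  have h3 := mul_le_mul_of_nonneg_left h2 (show 0 ≤ 1 + 18 / μ by positivity)
  have h4 := n2 q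
  linarith

end BBMB

/-! ### The choice of the constant. -/

theorem mainTheorem2 (μ lam L T a : ℝ) (hμ : 0 < μ) (hlam : 0 < lam) (hL : 0 < L) (hT : 0 < T)
    (φ : ℝ → ℝ) (u w : ℝ → ℝ → ℝ) (hu : BBMB.IsExactSolution μ lam L T φ u w) :
    ∃ C : ℝ, 0 < C ∧
      ∀ (M N : ℕ) (h τ : ℝ), 1 ≤ M → 1 ≤ N → h = L / M → τ = T / N →
      ∀ uc wc : ℕ → ℤ → ℝ, BBMB.IsNumericalSolution μ lam a h τ M N φ uc wc →
        2 * BBMB.C1 lam L (BBMB.C0 T u) * τ < 1 / 3 →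
        τ ^ 2 + h ^ 4 ≤ 1 / C →
        ∀ q : ℕ, q ≤ N →
          BBMB.seminormH1 M h (BBMB.gridError u a h τ uc q) ≤ C * (τ ^ 2 + h ^ 4) ∧
          BBMB.normL2 M h (BBMB.gridError u a h τ uc q)
            ≤ L * C / Real.sqrt 6 * (τ ^ 2 + h ^ 4) ∧
          BBMB.normMax M (BBMB.gridError u a h τ uc q)
            ≤ C * Real.sqrt L / 2 * (τ ^ 2 + h ^ 4) := by
  obtain ⟨K, D, E, hK, H⟩ := hu.exists_data hL hT
  set κ : ℝ := (K + 1) * (L ^ 2 + 2) * (1 + 18 / μ) with hκ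
  set G : ℝ := (1 + 18 / μ) * (2 * L * T * BBMB.ExactData.consistencyConst μ lam L K ^ 2
    * Real.exp (4 * κ * T)) with hG
  have hκ0 : 0 < κ := by positivity
  have hG0 : 0 ≤ G := by positivity
  have hsL : 0 < √L := Real.sqrt_pos.2 hL
  have hs6 : 0 < √6 := Real.sqrt_pos.2 (by norm_num)
  have hB : 0 ≤ √G := Real.sqrt_nonneg G
  -- One summand for each demand: `1` for positivity, `4κ²` so that `τ² ≤ 1/C` gives `2κτ ≤ 1`, and
  -- the last three for the seminorm, the `L²` norm and the maximum norm with their prescribed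
  -- factors.
  set C : ℝ := 1 + 4 * κ ^ 2 + √G + √6 / L * √G + 2 / √L * ((1 / √L + √L) * √G) with hC
  have k1 : 0 ≤ √6 / L * √G := by positivity
  have k2 : 0 ≤ 2 / √L * ((1 / √L + √L) * √G) := by positivity
  have k3 : 0 ≤ 4 * κ ^ 2 := by positivity
  have hC0 : 0 < C := by linarith
  refine ⟨C, hC0, ?_⟩
  intro M N h τ hM hN hh hτ uc wc hc _ hsmall q hq
  have hM0 : (0 : ℝ) < M := by exact_mod_cast hM
  have hN0 : (0 : ℝ) < N := by exact_mod_cast hN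
  have hhL : M * h = L := by rw [hh]; field_simp
  have hτT : N * τ = T := by rw [hτ]; field_simp
  have hh0 : 0 < h := by rw [hh]; positivity
  have hτ0 : 0 < τ := by rw [hτ]; positivity
  have hr : 0 ≤ τ ^ 2 + h ^ 4 := by positivity
  have hκτ : 2 * (κ * τ) ≤ 1 := by
    rw [le_div_iff₀ hC0] at hsmall
    have h1 : τ ^ 2 * (4 * κ ^ 2) ≤ (τ ^ 2 + h ^ 4) * C :=
      mul_le_mul (by linarith [pow_pos hh0 4]) (by linarith) k3 hr
    exact abs_le_one_iff_mul_self_le_one.2 (by linarith) |> (le_abs_self _).trans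
  have key := BBMB.energy_error_le H hu.initial hμ hlam hL hT hK hM hhL hτT hc hκτ q hq
  set e := BBMB.gridError u a h τ uc q
  have n1 := BBMB.gridInner_self_nonneg M hh0 e
  have n2 := BBMB.gridInner_self_nonneg M hh0 (BBMB.dxHalf h e)
  have hGr : √(G * (τ ^ 2 + h ^ 4) ^ 2) = √G * (τ ^ 2 + h ^ 4) := by
    rw [Real.sqrt_mul hG0, Real.sqrt_sq hr]
  have b1 : BBMB.seminormH1 M h e ≤ √G * (τ ^ 2 + h ^ 4) := by
    rw [← hGr]
    exact Real.sqrt_le_sqrt (show BBMB.gridInner M h (BBMB.dxHalf h e) (BBMB.dxHalf h e) ≤ _ by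
      linarith)
  have b2 : BBMB.normL2 M h e ≤ √G * (τ ^ 2 + h ^ 4) := by
    rw [← hGr]
    exact Real.sqrt_le_sqrt (show BBMB.gridInner M h e e ≤ _ by linarith)
  refine ⟨b1.trans (mul_le_mul_of_nonneg_right (by linarith) hr),
    b2.trans (mul_le_mul_of_nonneg_right ?_ hr), ?_⟩
  · rw [le_div_iff₀ hs6]
    have : L * (√6 / L * √G) ≤ L * C := mul_le_mul_of_nonneg_left (by linarith) hL.le
    have e1 : L * (√6 / L * √G) = √G * √6 := by field_simp
    linarith
  · have b3 := BBMB.normMax_le hM hh0 hL hhL e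
    have b4 : BBMB.normL2 M h e / √L ≤ √G * (τ ^ 2 + h ^ 4) / √L := by gcongr
    have b5 := mul_le_mul_of_nonneg_left b1 hsL.le
    have b6 : (1 / √L + √L) * √G ≤ C * √L / 2 := by
      have : √L / 2 * (2 / √L * ((1 / √L + √L) * √G)) ≤ √L / 2 * C :=
        mul_le_mul_of_nonneg_left (by linarith) (by positivity)
      have e1 : √L / 2 * (2 / √L * ((1 / √L + √L) * √G)) = (1 / √L + √L) * √G := by field_simp
      linarith
    have b7 := mul_le_mul_of_nonneg_right b6 hr
    calc BBMB.normMax M e ≤ √G * (τ ^ 2 + h ^ 4) / √L + √L * (√G * (τ ^ 2 + h ^ 4)) := by linarith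
      _ = (1 / √L + √L) * √G * (τ ^ 2 + h ^ 4) := by ring
      _ ≤ _ := b7
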